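/- \textbf{Notation.} Let $n\ge 0$, $[n]=\{1,\dots,n\}$, $\bar I=[n]\setminus I$ for $I\subset[n]$, and let $\mathcal I_k$ be the set of $k$-element subsets of $[n]$. Let $\lambda,y,z_1,\dots,z_n$ be variables, let $\mathbb F=\mathbb C(\lambda,y,z_1,\dots,z_n)$, and let $\mathcal L\subset\mathbb F$ be the algebra of rational functions $f/g$ with $f$ a polynomial and $g$ a finite product of factors $\lambda+ly$ ($l\in\mathbb Z$), $z_i-z_j$ ($i\ne j$), $z_i-z_j-y$. Let $v_1,v_2$ be the standard basis of $\mathbb C^2$; for $I\subset[n]$ let $v_I=v_{i_1}\otimes\dots\otimes v_{i_n}$ with $i_j=1$ if $j\in I$ and $i_j=2$ if $j\notin I$. Let $h(v_1)=1$, $h(v_2)=-1$, and let $h^{(j)}v_{i_1}\otimes\dots\otimes v_{i_n}=h(v_{i_j})\,v_{i_1}\otimes\dots\otimes v_{i_n}$. \textbf{Operators.} In the basis $v_1\otimes v_1,v_1\otimes v_2,v_2\otimes v_1,v_2\otimes v_2$ let \[ R(\lambda,z)=\begin{pmatrix}1&0&0&0\\0&\frac{(\lambda+y)z}{\lambda(z-y)}&-\frac{(\lambda+z)y}{\lambda(z-y)}&0\\0&-\frac{(\lambda-z)y}{\lambda(z-y)}&\frac{(\lambda-y)z}{\lambda(z-y)}&0\\0&0&0&1\end{pmatrix},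 \] and let $R^{(i,i+1)}$ denote its action in the factors $i,i+1$ of $(\mathbb C^2)^{\otimes n}$. Let $P^{(i,i+1)}$ exchange the factors $i$ and $i+1$, and let $K^{(i,i+1)}$ exchange the variables $z_i$ and $z_{i+1}$ in vector-valued rational functions. For $1\le i<n$ put \[ \tilde s_i=R^{(i,i+1)}\Bigl(\lambda-y\sum_{m=i+2}^n h^{(m)},\,z_i-z_{i+1}\Bigr)\circ P^{(i,i+1)}\circ K^{(i,i+1)}, \] where $R^{(i,i+1)}(\lambda-y\sum_m h^{(m)},\cdot)$ acts on $v_J$ with $\sum_{m\ge i+2}h^{(m)}v_J=\mu v_J$ as $R^{(i,i+1)}(\lambda-y\mu,\cdot)$. These are $\mathbb C$-linear operators on $(\mathbb C^2)^{\otimes n}\otimes\mathbb F$. \textbf{Vectors.} For $I=\{i_1<\dots<i_k\}\in\mathcal I_k$ and $i\in[n]$ let $w(i,I)=-\#\{j>i: j\in\bar I\}+\#\{j>i: j\in I\}$, and let \[ W_I(\lambda,t,z,y)=y^k\sum_{\tau\in S_k}\Bigl(\prod_{r=1}^k\prod_{a=1}^n l_I(r,a)\prod_{1\le a<b\le k}\frac{t_a-t_b+y}{t_a-t_b}\Bigr)\Big|_{t_a\mapsto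 t_{\tau(a)}}, \] where $l_I(r,a)=t_r-z_a+y$ if $a<i_r$, $l_I(r,a)=\lambda+t_r-z_a-w(i_r,I)y$ if $a=i_r$, and $l_I(r,a)=t_r-z_a$ if $a>i_r$. Put \[ W_{\sigma,I}(\lambda,t,z,y)=W_{\sigma^{-1}(I)}(\lambda,t,z_{\sigma(1)},\dots,z_{\sigma(n)},y)\qquad(\sigma\in S_n), \] \[ \tilde W^-_J(\lambda,t,z,y)=\frac{(-1)^k}{\prod_{a,b=1}^k(t_a-t_b+y)}\,W_{s_0,J}(-\lambda-(n-2k)y,t,z,y),\qquad s_0(i)=n+1-i, \] \[ \xi_I=\prod_{a\in I}\prod_{b\in\bar I}\frac1{z_a-z_b+y}\ \sum_{J\in\mathcal I_k}\tilde W^-_J(\lambda,z_I,z,y)\,v_J, \] where $z_I$ means the substitution $\{t_1,\dots,t_k\}\mapsto\{z_a: a\in I\}$. \textbf{Proposition.} (1) The operators $\tilde s_i$ satisfy $\tilde s_i^2=1$, $\tilde s_{i+1}\tilde s_i\tilde s_{i+1}=\tilde s_i\tilde s_{i+1}\tilde s_i$, and $\tilde s_i\tilde s_j=\tilde s_j\tilde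 s_i$ for $|i-j|>1$; hence there is a unique action of $S_n$ on $(\mathbb C^2)^{\otimes n}\otimes\mathbb F$ by $\mathbb C$-linear operators in which each simple transposition $s_i=(i,i+1)$ acts as $\tilde s_i$. This action preserves $(\mathbb C^2)^{\otimes n}\otimes\mathcal L$. Moreover $\tilde s_i z_i=z_{i+1}\tilde s_i$, $\tilde s_i z_{i+1}=z_i\tilde s_i$, and $\tilde s_i z_j=z_j\tilde s_i$ for $j\ne i,i+1$, where $z_j$ denotes the operator of multiplication by $z_j$. (2) For all $0\le k\le n$ and $I\in\mathcal I_k$ we have $\xi_I\in(\mathbb C^2)^{\otimes n}\otimes\mathcal L$, and for all $1\le i<n$ \[ \xi_{s_i(I)}=\tilde s_i\,\xi_I . \] -/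

import Mathlib

open scoped TensorProduct

noncomputable section

namespace DynXi

/-! ### Index sets -/

/-- `Subsets n k` is the set of `k`-element subsets of `{1, …, n}`, modelled on `Fin n`. -/
abbrev Subsets (n k : ℕ) : Type := {I : Finset (Fin n) // I.card = k}

/-- `σ(I) = {σ(i) : i ∈ I}`. -/
def permSubset {n k : ℕ} (σ : Equiv.Perm (Fin n)) (I : Subsets n k) : Subsets n k :=
  ⟨I.1.map σ.toEmbedding, by rw [Finset.card_map]; exact I.2⟩

/-- The simple transposition of the (0-based) positions `i` and `i + 1`. -/
def simpleRefl {n : ℕ} (i : ℕ) (hi : i + 1 < n) : Equiv.Perm (Fin n) :=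
  Equiv.swap ⟨i, by omega⟩ ⟨i + 1, hi⟩

/-- `elt I r` is the `r`-th smallest element `i_r` of `I = {i_1 < … < i_k}`. -/
def elt {n k : ℕ} (I : Subsets n k) (r : Fin k) : Fin n :=
  I.1.orderEmbOfFin I.2 r

/-! ### Weight functions

The weight functions are rational functions of `λ, t, z, y`; they are written as functions of values
of these variables in an arbitrary field, and are used below only at values where all their
denominators are nonzero. -/

/-- `w(i, I) = -#{j > i : j ∉ I} + #{j > i : j ∈ I}`. -/
def wt {n k : ℕ} (i : Fin n) (I : Subsets n k) : ℤ :=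
  -((Finset.univ.filter fun j : Fin n => i < j ∧ j ∉ I.1).card : ℤ) +
    ((Finset.univ.filter fun j : Fin n => i < j ∧ j ∈ I.1).card : ℤ)

section Weight

variable {K : Type*} [Field K] {n k : ℕ}

/-- The factor `l_I(r, a)`. -/
def lFactor (I : Subsets n k) (lam : K) (t : Fin k → K) (z : Fin n → K) (y : K)
    (r : Fin k) (a : Fin n) : K :=
  if a < elt I r then t r - z a + y
  else if a = elt I r then lam + t r - z a - (wt (elt I r) I : K) * y
  else t r - z a

/-- The weight function `W_I(λ, t, z, y)`, the symmetrization over `S_k` being written out. -/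
def W (I : Subsets n k) (lam : K) (t : Fin k → K) (z : Fin n → K) (y : K) : K :=
  y ^ k * ∑ τ : Equiv.Perm (Fin k),
    ((∏ r : Fin k, ∏ a : Fin n, lFactor I lam (t ∘ τ) z y r a) *
      ∏ a : Fin k, ∏ b ∈ Finset.Ioi a, (t (τ a) - t (τ b) + y) / (t (τ a) - t (τ b)))

/-- `W_{σ,I}(λ, t, z, y) = W_{σ⁻¹(I)}(λ, t, z_{σ(1)}, …, z_{σ(n)}, y)`. -/
def WPerm (σ : Equiv.Perm (Fin n)) (I : Subsets n k) (lam : K) (t : Fin k → K) (z : Fin n → K)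
    (y : K) : K :=
  W (permSubset σ⁻¹ I) lam t (z ∘ σ) y

/-- `e_k(t, y) = ∏_{a, b} (t_a - t_b + y)`. -/
def eK (t : Fin k → K) (y : K) : K := ∏ a : Fin k, ∏ b : Fin k, (t a - t b + y)

/-- The modified weight function
`W̃⁻_J = (-1)^k / e_k · W_{s₀,J}(-λ - (n - 2k) y, t, z, y)`, with `s₀` the longest permutation. -/
def WMinus (J : Subsets n k) (lam : K) (t : Fin k → K) (z : Fin n → K) (y : K) : K :=
  (-1) ^ k / eK t y * WPerm Fin.revPerm J (-lam - ((n : K) - 2 * (k : K)) * y) t z y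

/-- `Q_I(z, y) = ∏_{a ∈ I} ∏_{b ∉ I} (z_a - z_b + y)`. -/
def Q (I : Subsets n k) (z : Fin n → K) (y : K) : K :=
  ∏ a ∈ I.1, ∏ b ∈ I.1ᶜ, (z a - z b + y)

/-- The rational dynamical R-matrix in the basis `v₁⊗v₁, v₁⊗v₂, v₂⊗v₁, v₂⊗v₂`
(the columns are the images of the basis vectors); `v₁, v₂` have indices `0, 1`. -/
def dynR (lam z y : K) : Matrix (Fin 2 × Fin 2) (Fin 2 × Fin 2) K :=
  (!![1, 0, 0, 0;
      0, (lam + y) * z / (lam * (z - y)), -((lam + z) * y) / (lam * (z - y)), 0;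
      0, -((lam - z) * y) / (lam * (z - y)), (lam - y) * z / (lam * (z - y)), 0;
      0, 0, 0, 1] : Matrix (Fin 4) (Fin 4) K).submatrix finProdFinEquiv finProdFinEquiv

end Weight

/-! ### Rational functions -/

/-- The variables `λ, y, z₁, …, zₙ`. -/
inductive Var (n : ℕ) : Type
  | lam : Var n
  | y : Var n
  | z (i : Fin n) : Var n

/-- The field of all rational functions in `λ, y, z₁, …, zₙ` over `ℂ`. -/
abbrev F (n : ℕ) : Type := FractionRing (MvPolynomial (Var n) ℂ)

/-- A variable as a rational function. -/
def X {n : ℕ} (v : Var n) : F n := algebraMap (MvPolynomial (Var n) ℂ) (F n) (MvPolynomial.X v)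

/-- The rational function `λ`. -/
def lamF (n : ℕ) : F n := X Var.lam

/-- The rational function `y`. -/
def yF (n : ℕ) : F n := X Var.y

/-- The rational functions `z₁, …, zₙ`. -/
def zF (n : ℕ) (i : Fin n) : F n := X (Var.z i)

/-- The permitted denominators: products of factors `λ + l y` (`l ∈ ℤ`), `z_i - z_j` (`i ≠ j`)
and `z_i - z_j - y`. -/
def denoms (n : ℕ) : Submonoid (MvPolynomial (Var n) ℂ) :=
  Submonoid.closure
    ({p | ∃ l : ℤ, p = MvPolynomial.X Var.lam + (l : MvPolynomial (Var n) ℂ) * MvPolynomial.X Var.y} ∪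
     {p | ∃ i j : Fin n, i ≠ j ∧ p = MvPolynomial.X (Var.z i) - MvPolynomial.X (Var.z j)} ∪
     {p | ∃ i j : Fin n,
        p = MvPolynomial.X (Var.z i) - MvPolynomial.X (Var.z j) - MvPolynomial.X Var.y})

lemma denoms_le (n : ℕ) : denoms n ≤ nonZeroDivisors (MvPolynomial (Var n) ℂ) := by
  classical
  refine Submonoid.closure_le.2 ?_
  rintro p ((⟨l, rfl⟩ | ⟨i, j, hij, rfl⟩) | ⟨i, j, rfl⟩) <;>
    refine mem_nonZeroDivisors_of_ne_zero fun h => ?_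
  · have := congrArg (MvPolynomial.eval fun v : Var n => match v with
      | Var.lam => (1 : ℂ) | _ => 0) h
    simp at this
  · have := congrArg (MvPolynomial.eval fun v : Var n => match v with
      | Var.z a => if a = i then (1 : ℂ) else 0 | _ => 0) h
    simp [hij.symm] at this
  · have := congrArg (MvPolynomial.eval fun v : Var n => match v with
      | Var.y => (1 : ℂ) | _ => 0) h
    simp at this

/-- The algebra `L_{λ,z,y}` of the rational functions `f / g` with `f` a polynomial and `g` a
permitted denominator. -/
def L (n : ℕ) : Subalgebra ℂ (F n) :=
  (Localization.subalgebra.ofField (F n) (denoms n) (denoms_le n)).restrictScalars ℂ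

/-- The permutation of variables `z_a ↦ z_{σ(a)}`, fixing `λ` and `y`. -/
def permVar {n : ℕ} (σ : Equiv.Perm (Fin n)) : Equiv.Perm (Var n) where
  toFun v := match v with
    | Var.lam => Var.lam
    | Var.y => Var.y
    | Var.z i => Var.z (σ i)
  invFun v := match v with
    | Var.lam => Var.lam
    | Var.y => Var.y
    | Var.z i => Var.z (σ.symm i)
  left_inv v := by cases v <;> simp
  right_inv v := by cases v <;> simp

/-- The substitution `z_a ↦ z_{σ(a)}` on rational functions. -/
def substZ {n : ℕ} (σ : Equiv.Perm (Fin n)) : F n ≃ₐ[ℂ] F n :=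
  IsFractionRing.algEquivOfAlgEquiv (MvPolynomial.renameEquiv ℂ (permVar σ))

/-! ### The tensor space -/

/-- `(ℂ²)^{⊗ n}`. -/
abbrev C2pow (n : ℕ) : Type := ⨂[ℂ] _ : Fin n, (Fin 2 → ℂ)

/-- `(ℂ²)^{⊗ n}` with coefficients in the field of rational functions. -/
abbrev V (n : ℕ) : Type := F n ⊗[ℂ] C2pow n

/-- The basis of elementary tensors `v_{w(1)} ⊗ … ⊗ v_{w(n)}`. -/
def vBasis (n : ℕ) : Module.Basis (Fin n → Fin 2) (F n) (V n) :=
  Algebra.TensorProduct.basis (F n) (Basis.piTensorProduct fun _ : Fin n => Pi.basisFun ℂ (Fin 2))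

lemma vBasis_apply (n : ℕ) (w : Fin n → Fin 2) :
    vBasis n w = 1 ⊗ₜ[ℂ] (⨂ₜ[ℂ] j, (Pi.single (w j) 1 : Fin 2 → ℂ)) := by
  simp [vBasis, Algebra.TensorProduct.basis_apply, Basis.piTensorProduct_apply]

/-- `v_I`, whose `j`-th factor is `v₁` if `j ∈ I` and `v₂` otherwise. -/
def vI {n : ℕ} (I : Finset (Fin n)) : V n := vBasis n fun j => if j ∈ I then 0 else 1

/-- `(ℂ²)^{⊗ n} ⊗ L_{λ,z,y}`, as a subspace of `(ℂ²)^{⊗ n}` with rational function coefficients. -/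
def lattice (n : ℕ) : Submodule ℂ (V n) :=
  LinearMap.range (LinearMap.rTensor (C2pow n) (L n).val.toLinearMap)

/-- `h(v₁) = 1`, `h(v₂) = -1`. -/
def hwt (a : Fin 2) : ℤ := if a = 0 then 1 else -1

/-- `R^{(i,j)}(λ - y ∑_{m ∈ S} h^{(m)}, x)`: the R-matrix acts in the factors `i` and `j`
(intended for `i ≠ j` and `i, j ∉ S`), with its dynamical parameter shifted by the weights of the
factors in `S`. -/
def RAt {n : ℕ} (i j : Fin n) (S : Finset (Fin n)) (x : F n) : V n →ₗ[F n] V n :=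
  (vBasis n).constr (F n) fun w =>
    ∑ p : Fin 2 × Fin 2,
      dynR (lamF n - yF n * ∑ m ∈ S, (hwt (w m) : F n)) x (yF n) p (w i, w j) •
        vBasis n (Function.update (Function.update w i p.1) j p.2)

/-- Permutation of the tensor factors: the factor in position `a` moves to position `σ(a)`. -/
def permFactors {n : ℕ} (σ : Equiv.Perm (Fin n)) : V n →ₗ[ℂ] V n :=
  LinearMap.lTensor (F n)
    (PiTensorProduct.reindex ℂ (fun _ : Fin n => (Fin 2 → ℂ)) σ).toLinearMap

/-- The substitution `z_a ↦ z_{σ(a)}` in vector-valued rational functions. -/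
def substV {n : ℕ} (σ : Equiv.Perm (Fin n)) : V n →ₗ[ℂ] V n :=
  LinearMap.rTensor (C2pow n) (substZ σ).toAlgHom.toLinearMap

/-- `s̃_i = R^{(i,i+1)}(λ - y ∑_{m ≥ i+2} h^{(m)}, z_i - z_{i+1}) ∘ P^{(i,i+1)} ∘ K^{(i,i+1)}`. -/
def sTilde {n : ℕ} (i : ℕ) (hi : i + 1 < n) : V n →ₗ[ℂ] V n :=
  (RAt ⟨i, by omega⟩ ⟨i + 1, hi⟩ (Finset.univ.filter fun m : Fin n => i + 2 ≤ (m : ℕ))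
      (zF n ⟨i, by omega⟩ - zF n ⟨i + 1, hi⟩)).restrictScalars ℂ ∘ₗ
    permFactors (simpleRefl i hi) ∘ₗ substV (simpleRefl i hi)

/-! ### The vectors `ξ_I` -/

/-- `ξ_I = Q_I(z, y)⁻¹ ∑_J W̃⁻_J(λ, z_I, z, y) v_J`, with `z_I = (z_a)_{a ∈ I}`. -/
def xi {n k : ℕ} (I : Subsets n k) : V n :=
  (Q I (zF n) (yF n))⁻¹ •
    ∑ J : Subsets n k, WMinus J (lamF n) (fun r => zF n (elt I r)) (zF n) (yF n) • vI J.1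

end DynXi

end

noncomputable section

namespace DynXi

/-! ### Adjacent transpositions and subsets -/

section Adjacent

variable {n k : ℕ} {a b : Fin n}

/-! The braid relations are never checked on the `R`-matrix. Part (2) is proved first, by comparing
coordinates, and part (1) is deduced from it.

Compare the coefficients of `v_J` in `ξ_{s_i(I)}` and `s̃_i ξ_I`. The substitution `K` carries the
coefficients of `ξ_I` to those of `ξ_{s_i(I)}` with only the parameters `z_i, z_{i+1}` exchanged
(`substZ_coeff`). What remains is a statement on weight functions. If `J` contains both or neither
of `i, i+1`, the function is symmetric in these parameters (`WMinus_swap_eq`). If it contains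
exactly one, a three-term relation whose coefficients are entries of `R` is needed
(`WMinus_eq_dynR`). The summands of the symmetrization involved differ only in two factors, so the
relation reduces to an identity of quadratic polynomials in one variable (`W_swap_linear`).

The `ξ_I`, for all `I`, are triangular in the `v_J` with nonzero diagonal, hence a basis over `𝔽`
(`linearIndependent_xi`). The rule `f ξ_I ↦ σ(f) ξ_{σ(I)}` plainly defines an action of `S_n`. By
part (2) and semilinearity (`sTilde_smul`), `s_i` acts in it as `s̃_i`. So the `s̃_i` inherit every
relation of the simple transpositions. Uniqueness and invariance of the lattice follow because these
generate `S_n`. -/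

lemma swap_lt_iff (hab : (a : ℕ) + 1 = b) {p : Fin n} (hb : p ≠ b) (q : Fin n) :
    Equiv.swap a b q < p ↔ q < p := by
  rw [Equiv.swap_apply_def]
  simp only [Fin.ext_iff, Fin.lt_def, ne_eq] at *
  split_ifs <;> omega

lemma lt_swap_iff (hab : (a : ℕ) + 1 = b) {p : Fin n} (ha : p ≠ a) (hb : p ≠ b) (q : Fin n) :
    p < Equiv.swap a b q ↔ p < q := by
  rw [Equiv.swap_apply_def]
  simp only [Fin.ext_iff, Fin.lt_def, ne_eq] at *
  split_ifs <;> omega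

lemma swap_lt_swap (hab : (a : ℕ) + 1 = b) {p q : Fin n} (hpq : p < q) (h : ¬(p = a ∧ q = b)) :
    Equiv.swap a b p < Equiv.swap a b q := by
  rw [Equiv.swap_apply_def, Equiv.swap_apply_def]
  simp only [Fin.ext_iff, Fin.lt_def] at *
  split_ifs <;> omega

lemma swap_eq_iff_of_ne {p : Fin n} (ha : p ≠ a) (hb : p ≠ b) (q : Fin n) :
    Equiv.swap a b q = p ↔ q = p := by
  rw [Equiv.swap_apply_eq_iff, Equiv.swap_apply_of_ne_of_ne ha hb]

lemma mem_permSubset (σ : Equiv.Perm (Fin n)) (I : Subsets n k) (j : Fin n) :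
    j ∈ (permSubset σ I).1 ↔ σ⁻¹ j ∈ I.1 := by
  simp only [permSubset, Finset.mem_map_equiv]
  rfl

lemma elt_mem (I : Subsets n k) (r : Fin k) : elt I r ∈ I.1 :=
  Finset.orderEmbOfFin_mem _ _ _

lemma elt_injective (I : Subsets n k) : Function.Injective (elt I) :=
  (I.1.orderEmbOfFin I.2).injective

lemma elt_strictMono (I : Subsets n k) : StrictMono (elt I) :=
  (I.1.orderEmbOfFin I.2).strictMono

lemma exists_elt_eq {I : Subsets n k} {j : Fin n} (hj : j ∈ I.1) : ∃ r, elt I r = j := by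
  have : j ∈ Set.range (I.1.orderEmbOfFin I.2) := by
    rw [Finset.range_orderEmbOfFin]; exact hj
  exact this

lemma sum_elt {M : Type*} [AddCommMonoid M] (I : Subsets n k) (f : Fin n → M) :
    ∑ r, f (elt I r) = ∑ j ∈ I.1, f j := by
  refine Finset.sum_bij (fun r _ => elt I r) (fun r _ => elt_mem I r)
    (fun r _ r' _ h => elt_injective I h) (fun j hj => ?_) fun _ _ => rfl
  obtain ⟨r, hr⟩ := exists_elt_eq hj
  exact ⟨r, Finset.mem_univ _, hr⟩

lemma exists_perm_comp_elt (σ : Equiv.Perm (Fin n)) (I : Subsets n k) :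
    ∃ π : Equiv.Perm (Fin k), σ ∘ elt I = elt (permSubset σ I) ∘ π := by
  have h : ∀ r, ∃ r', elt (permSubset σ I) r' = σ (elt I r) := fun r =>
    exists_elt_eq (by simpa [mem_permSubset] using elt_mem I r)
  choose f hf using h
  have hinj : Function.Injective f := fun r r' h => by
    have := congrArg (elt (permSubset σ I)) h
    rw [hf, hf] at this
    exact elt_injective I (σ.injective this)
  refine ⟨Equiv.ofBijective f (Finite.injective_iff_bijective.1 hinj), ?_⟩
  ext1 r
  exact (hf r).symm

/-- An adjacent transposition reverses the order of the pair `a, b` only. It is therefore increasing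
on `I` unless both lie in `I`, and then the sorted enumeration is carried along. -/
lemma elt_permSubset_swap (hab : (a : ℕ) + 1 = b) {I : Subsets n k}
    (h : ¬(a ∈ I.1 ∧ b ∈ I.1)) (r : Fin k) :
    elt (permSubset (Equiv.swap a b) I) r = Equiv.swap a b (elt I r) := by
  have := Finset.orderEmbOfFin_unique (permSubset (Equiv.swap a b) I).2
    (f := fun r => Equiv.swap a b (elt I r))
    (fun r => by simpa [mem_permSubset] using elt_mem I r)
    (fun p q hpq => swap_lt_swap hab (elt_strictMono I hpq) fun h' =>
      h ⟨h'.1 ▸ elt_mem I p, h'.2 ▸ elt_mem I q⟩)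
  exact (congrFun this r).symm

/-- The weight `1` of a position in `I`, or `-1` of a position outside `I`. -/
def memSign (I : Subsets n k) (j : Fin n) : ℤ := if j ∈ I.1 then 1 else -1

lemma wt_eq_sum (p : Fin n) (I : Subsets n k) :
    wt p I = ∑ j, if p < j then memSign I j else 0 := by
  rw [wt, Finset.card_filter, Finset.card_filter]
  push_cast
  rw [← Finset.sum_neg_distrib, ← Finset.sum_add_distrib]
  refine Finset.sum_congr rfl fun j _ => ?_
  by_cases h1 : p < j <;> by_cases h2 : j ∈ I.1 <;> simp [h1, h2, memSign]

lemma memSign_permSubset (σ : Equiv.Perm (Fin n)) (I : Subsets n k) (j : Fin n) :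
    memSign (permSubset σ I) j = memSign I (σ⁻¹ j) := by
  simp only [memSign, mem_permSubset]

lemma wt_permSubset_swap (hab : (a : ℕ) + 1 = b) {p : Fin n} (ha : p ≠ a) (hb : p ≠ b)
    (I : Subsets n k) : wt p (permSubset (Equiv.swap a b) I) = wt p I := by
  rw [wt_eq_sum, wt_eq_sum, ← Equiv.sum_comp (Equiv.swap a b)]
  simp only [lt_swap_iff hab ha hb, memSign_permSubset, Equiv.swap_inv, Equiv.swap_apply_self]

lemma wt_permSubset_swap_right (hab : (a : ℕ) + 1 = b) (I : Subsets n k) :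
    wt b (permSubset (Equiv.swap a b) I) = wt b I := by
  rw [wt_eq_sum, wt_eq_sum]
  refine Finset.sum_congr rfl fun j _ => ?_
  by_cases h : b < j
  · rw [if_pos h, if_pos h, memSign_permSubset, Equiv.swap_inv,
      Equiv.swap_apply_of_ne_of_ne _ h.ne']
    rintro rfl
    rw [Fin.lt_def] at h
    omega
  · rw [if_neg h, if_neg h]

lemma wt_left (hab : (a : ℕ) + 1 = b) (I : Subsets n k) :
    wt a I = memSign I b + wt b I := by
  rw [wt_eq_sum, wt_eq_sum, ← Finset.sum_erase_add _ _ (Finset.mem_univ b),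
    ← Finset.sum_erase_add _ (fun j => if b < j then memSign I j else 0) (Finset.mem_univ b)]
  rw [if_pos (by rw [Fin.lt_def]; omega), if_neg (lt_irrefl b), add_zero, add_comm]
  congr 1
  refine Finset.sum_congr rfl fun j hj => ?_
  have hj' : j ≠ b := Finset.ne_of_mem_erase hj
  have : a < j ↔ b < j := by
    simp only [Fin.lt_def, Fin.ext_iff, ne_eq] at *
    omega
  simp only [this]

lemma sum_memSign (I : Subsets n k) : ∑ j, memSign I j = 2 * k - n := by
  have h := Finset.sum_boole (R := ℤ) (fun j => j ∈ I.1) Finset.univ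
  have : ∀ j, memSign I j = 2 * (if j ∈ I.1 then (1 : ℤ) else 0) - 1 := fun j => by
    unfold memSign; split_ifs <;> norm_num
  simp only [this, Finset.sum_sub_distrib, ← Finset.mul_sum, h]
  simp [I.2]

end Adjacent

/-! ### Weight functions -/

section WeightFunctions

variable {K : Type*} [Field K] {n k : ℕ} {a b : Fin n}

/-- The product of the factors of a weight function which involve a single variable `x = t_r`,
where `p = i_r` and `c = w(i_r, I)`. -/
def rowProd (lam y : K) (z : Fin n → K) (p : Fin n) (c : ℤ) (x : K) : K :=
  ∏ q : Fin n, if q < p then x - z q + y else if q = p then lam + x - z q - (c : K) * y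
    else x - z q

/-- The factors of `rowProd` away from `a` and `b`, for `p ∈ {a, b}`. -/
def rowRest (y : K) (z : Fin n → K) (a b : Fin n) (x : K) : K :=
  ∏ q ∈ ({a, b} : Finset (Fin n))ᶜ, if q < a then x - z q + y else x - z q

/-- The product `∏_{r < s} (t_r - t_s + y) / (t_r - t_s)`. -/
def pairProd (y : K) (t : Fin k → K) : K :=
  ∏ r : Fin k, ∏ s ∈ Finset.Ioi r, (t r - t s + y) / (t r - t s)

lemma W_eq_sum (I : Subsets n k) (lam : K) (t : Fin k → K) (z : Fin n → K) (y : K) :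
    W I lam t z y = y ^ k * ∑ τ : Equiv.Perm (Fin k),
      (∏ r, rowProd lam y z (elt I r) (wt (elt I r) I) (t (τ r))) * pairProd y (t ∘ τ) := rfl

/-- Symmetry in `t` is what makes the substitution of an unordered set `z_I` meaningful; later it
absorbs every reordering of `z_I`. -/
lemma W_comp_perm (I : Subsets n k) (lam : K) (t : Fin k → K) (z : Fin n → K) (y : K)
    (π : Equiv.Perm (Fin k)) : W I lam (t ∘ π) z y = W I lam t z y := by
  rw [W_eq_sum, W_eq_sum]
  exact congrArg _ (Equiv.sum_comp (Equiv.mulLeft π) fun τ : Equiv.Perm (Fin k) =>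
    (∏ r, rowProd lam y z (elt I r) (wt (elt I r) I) (t (τ r))) * pairProd y (t ∘ τ))

lemma prod_eq_mul_prod_compl_pair {ι M : Type*} [Fintype ι] [DecidableEq ι] [CommMonoid M]
    {a b : ι} (hab : a ≠ b) (f : ι → M) :
    ∏ q, f q = f a * f b * ∏ q ∈ ({a, b} : Finset ι)ᶜ, f q := by
  rw [← Finset.prod_pair hab, Finset.prod_mul_prod_compl]

lemma rowProd_swap (hab : (a : ℕ) + 1 = b) (lam y : K) (z : Fin n → K) {p : Fin n}
    (ha : p ≠ a) (hb : p ≠ b) (c : ℤ) (x : K) :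
    rowProd lam y (z ∘ Equiv.swap a b) p c x = rowProd lam y z p c x := by
  unfold rowProd
  conv_rhs => rw [← Equiv.prod_comp (Equiv.swap a b)]
  simp only [swap_lt_iff hab hb, swap_eq_iff_of_ne ha hb, Function.comp_apply]

lemma rowRest_swap (y : K) (z : Fin n → K) (x : K) :
    rowRest y (z ∘ Equiv.swap a b) a b x = rowRest y z a b x := by
  refine Finset.prod_congr rfl fun q hq => ?_
  simp only [Finset.mem_compl, Finset.mem_insert, Finset.mem_singleton, not_or] at hq
  rw [Function.comp_apply, Equiv.swap_apply_of_ne_of_ne hq.1 hq.2]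

lemma rowProd_left (hab : (a : ℕ) + 1 = b) (lam y : K) (z : Fin n → K) (c : ℤ) (x : K) :
    rowProd lam y z a c x = (lam + x - z a - c * y) * (x - z b) * rowRest y z a b x := by
  have h : a < b := by rw [Fin.lt_def]; omega
  rw [rowProd, prod_eq_mul_prod_compl_pair h.ne]
  simp only [lt_irrefl, if_false, if_true, h.not_gt, h.ne', rowRest]
  congr 1
  refine Finset.prod_congr rfl fun q hq => ?_
  simp only [Finset.mem_compl, Finset.mem_insert, Finset.mem_singleton, not_or] at hq
  rw [if_neg hq.1]

lemma rowProd_right (hab : (a : ℕ) + 1 = b) (lam y : K) (z : Fin n → K) (c : ℤ) (x : K) :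
    rowProd lam y z b c x = (x - z a + y) * (lam + x - z b - c * y) * rowRest y z a b x := by
  have h : a < b := by rw [Fin.lt_def]; omega
  rw [rowProd, prod_eq_mul_prod_compl_pair h.ne]
  simp only [lt_irrefl, if_false, if_true, h, rowRest]
  congr 1
  refine Finset.prod_congr rfl fun q hq => ?_
  simp only [Finset.mem_compl, Finset.mem_insert, Finset.mem_singleton, not_or] at hq
  have : q < b ↔ q < a := by
    simp only [Fin.lt_def, Fin.ext_iff] at *
    omega
  rw [if_neg hq.2]
  simp only [this]

lemma W_swap_of_notMem (hab : (a : ℕ) + 1 = b) {I : Subsets n k} (ha : a ∉ I.1) (hb : b ∉ I.1)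
    (lam : K) (t : Fin k → K) (z : Fin n → K) (y : K) :
    W I lam t (z ∘ Equiv.swap a b) y = W I lam t z y := by
  rw [W_eq_sum, W_eq_sum]
  congr 1
  refine Finset.sum_congr rfl fun τ _ => ?_
  congr 1
  refine Finset.prod_congr rfl fun r _ => rowProd_swap hab _ _ _ ?_ ?_ _ _
  · rintro rfl; exact ha (elt_mem I r)
  · rintro rfl; exact hb (elt_mem I r)

/-- A linear relation between the four products of the factors at `a` and `b` gives the same
relation between weight functions. -/
lemma W_swap_linear (hab : (a : ℕ) + 1 = b) {I : Subsets n k} (ha : a ∈ I.1) (hb : b ∉ I.1)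
    (lam : K) (t : Fin k → K) (z : Fin n → K) (y : K) (c₁ c₂ c₃ c₄ m : K)
    (hm : m = lam - wt b I * y)
    (h : ∀ x, c₁ * ((m + x - z a + y) * (x - z b)) + c₂ * ((m + x - z b + y) * (x - z a)) +
      c₃ * ((x - z a + y) * (m + x - z b)) + c₄ * ((x - z b + y) * (m + x - z a)) = 0) :
    c₁ * W I lam t z y + c₂ * W I lam t (z ∘ Equiv.swap a b) y +
      c₃ * W (permSubset (Equiv.swap a b) I) lam t z y +
      c₄ * W (permSubset (Equiv.swap a b) I) lam t (z ∘ Equiv.swap a b) y = 0 := by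
  obtain ⟨r₀, hr₀⟩ := exists_elt_eq ha
  have hnot : ¬(a ∈ I.1 ∧ b ∈ I.1) := fun h => hb h.2
  set J := permSubset (Equiv.swap a b) I with hJ
  have helt : ∀ r, elt J r = Equiv.swap a b (elt I r) := elt_permSubset_swap hab hnot
  -- The position `b` lies outside `I` and contributes `-1`; this produces the extra `+ y` beside
  -- `m` in the first two products of `h`.
  have hwa : wt a I = wt b I - 1 := by
    rw [wt_left hab, memSign, if_neg hb]; ring
  have hwb : wt b J = wt b I := wt_permSubset_swap_right hab I
  have hne : ∀ r ∈ Finset.univ.erase r₀, elt I r ≠ a ∧ elt I r ≠ b := fun r hr =>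
    ⟨fun h => Finset.ne_of_mem_erase hr (elt_injective I (h.trans hr₀.symm)),
      fun h => hb (h ▸ elt_mem I r)⟩
  have key : ∀ (I' : Subsets n k) (z' : Fin n → K) (p : Fin n) (x : Fin k → K),
      elt I' r₀ = p →
      (∀ r ∈ Finset.univ.erase r₀,
        rowProd lam y z' (elt I' r) (wt (elt I' r) I') (x r) =
          rowProd lam y z (elt I r) (wt (elt I r) I) (x r)) →
      ∏ r, rowProd lam y z' (elt I' r) (wt (elt I' r) I') (x r) =
        rowProd lam y z' p (wt p I') (x r₀) *
          ∏ r ∈ Finset.univ.erase r₀, rowProd lam y z (elt I r) (wt (elt I r) I) (x r) := by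
    intro I' z' p x hp hx
    rw [← Finset.mul_prod_erase _ _ (Finset.mem_univ r₀), hp, Finset.prod_congr rfl hx]
  have h1 := fun x => key I z a x hr₀ fun _ _ => rfl
  have h2 := fun x => key I (z ∘ Equiv.swap a b) a x hr₀ fun r hr =>
    rowProd_swap hab _ _ _ (hne r hr).1 (hne r hr).2 _ _
  have hJr : ∀ r ∈ Finset.univ.erase r₀, elt J r = elt I r := fun r hr => by
    rw [helt, Equiv.swap_apply_of_ne_of_ne (hne r hr).1 (hne r hr).2]
  have h3 := fun x => key J z b x (by rw [helt, hr₀, Equiv.swap_apply_left]) fun r hr => by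
    rw [hJr r hr, wt_permSubset_swap hab (hne r hr).1 (hne r hr).2]
  have h4 := fun x => key J (z ∘ Equiv.swap a b) b x
    (by rw [helt, hr₀, Equiv.swap_apply_left]) fun r hr => by
    rw [hJr r hr, wt_permSubset_swap hab (hne r hr).1 (hne r hr).2,
      rowProd_swap hab _ _ _ (hne r hr).1 (hne r hr).2]
  simp only [W_eq_sum, mul_left_comm _ (y ^ k), ← mul_add]
  refine mul_eq_zero_of_right _ ?_
  simp only [Finset.mul_sum, ← Finset.sum_add_distrib]
  -- The relation holds separately for each `τ`: all four terms share the other rows, `rowRest` and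
  -- `pairProd`, and what is left is `h` at `x = t (τ r₀)`.
  refine Finset.sum_eq_zero fun τ _ => ?_
  rw [h1 fun r => t (τ r), h2 fun r => t (τ r), h3 fun r => t (τ r), h4 fun r => t (τ r)]
  simp only [rowProd_left hab, rowProd_right hab, rowRest_swap, Function.comp_apply,
    Equiv.swap_apply_left, Equiv.swap_apply_right, hwa, hwb]
  have := h (t (τ r₀))
  rw [hm] at this
  push_cast
  linear_combination (rowRest y z a b (t (τ r₀)) *
    (∏ r ∈ Finset.univ.erase r₀, rowProd lam y z (elt I r) (wt (elt I r) I) (t (τ r))) *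
      pairProd y (t ∘ τ)) * this

/-- The factors of `pairProd` other than the one at `(r₀, r₁)`. -/
def pairRest (y : K) (t : Fin k → K) (r₀ r₁ : Fin k) : K :=
  ∏ p ∈ (Finset.univ.filter fun p : Fin k × Fin k => p.1 < p.2).erase (r₀, r₁),
    (t p.1 - t p.2 + y) / (t p.1 - t p.2)

lemma pairProd_eq (y : K) (t : Fin k → K) {r₀ r₁ : Fin k} (h : r₀ < r₁) :
    pairProd y t = (t r₀ - t r₁ + y) / (t r₀ - t r₁) * pairRest y t r₀ r₁ := by
  rw [pairRest, Finset.mul_prod_erase _ (fun p : Fin k × Fin k =>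
    (t p.1 - t p.2 + y) / (t p.1 - t p.2)) (by simpa using h : (r₀, r₁) ∈ _), pairProd,
    Finset.prod_filter, Fintype.prod_prod_type]
  refine Finset.prod_congr rfl fun r _ => ?_
  rw [← Finset.prod_filter]
  refine Finset.prod_congr ?_ fun _ _ => rfl
  ext s
  simp

/-- Exchanging two consecutive indices permutes the pairs `r < s` other than `(r₀, r₁)` itself. -/
lemma pairRest_swap (y : K) (t : Fin k → K) {r₀ r₁ : Fin k} (h : (r₀ : ℕ) + 1 = r₁) :
    pairRest y (t ∘ Equiv.swap r₀ r₁) r₀ r₁ = pairRest y t r₀ r₁ := by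
  have hmaps : ∀ p ∈ (Finset.univ.filter fun p : Fin k × Fin k => p.1 < p.2).erase (r₀, r₁),
      (Equiv.swap r₀ r₁ p.1, Equiv.swap r₀ r₁ p.2) ∈
        (Finset.univ.filter fun p : Fin k × Fin k => p.1 < p.2).erase (r₀, r₁) := by
    rintro ⟨p, q⟩ hp
    simp only [Finset.mem_erase, Finset.mem_filter, Finset.mem_univ, true_and, ne_eq,
      Prod.mk.injEq] at hp ⊢
    refine ⟨fun h' => ?_, swap_lt_swap h hp.2 hp.1⟩
    rw [Equiv.swap_apply_eq_iff, Equiv.swap_apply_eq_iff, Equiv.swap_apply_left,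
      Equiv.swap_apply_right] at h'
    have := hp.2
    rw [h'.1, h'.2, Fin.lt_def] at this
    omega
  refine Finset.prod_bij' (fun p _ => (Equiv.swap r₀ r₁ p.1, Equiv.swap r₀ r₁ p.2))
    (fun p _ => (Equiv.swap r₀ r₁ p.1, Equiv.swap r₀ r₁ p.2)) hmaps hmaps ?_ ?_ ?_
  · intro p _; simp
  · intro p _; simp
  · intro p _; rfl

/-- Single summands are not symmetric in `z_a, z_b`; the sum of the terms of `τ` and `τ * swap r₀
r₁` is. Injectivity of `t` keeps the denominator of the pair `(r₀, r₁)` nonzero. -/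
lemma W_swap_of_mem (hab : (a : ℕ) + 1 = b) {I : Subsets n k} (ha : a ∈ I.1) (hb : b ∈ I.1)
    (lam : K) {t : Fin k → K} (ht : Function.Injective t) (z : Fin n → K) (y : K) :
    W I lam t (z ∘ Equiv.swap a b) y = W I lam t z y := by
  obtain ⟨r₀, hr₀⟩ := exists_elt_eq ha
  obtain ⟨r₁, hr₁⟩ := exists_elt_eq hb
  have hlt : r₀ < r₁ := (elt_strictMono I).lt_iff_lt.1 (by
    rw [hr₀, hr₁, Fin.lt_def]; omega)
  -- An index strictly between would give an element of `I` strictly between the neighbours `a` and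
  -- `b`.
  have hr : (r₀ : ℕ) + 1 = r₁ := by
    by_contra hne
    have hs : (r₀ : ℕ) + 1 < k := by have := r₁.2; rw [Fin.lt_def] at hlt; omega
    have h1 := elt_strictMono I (show r₀ < ⟨(r₀ : ℕ) + 1, hs⟩ from Nat.lt_succ_self _)
    have h2 := elt_strictMono I (show (⟨(r₀ : ℕ) + 1, hs⟩ : Fin k) < r₁ by
      rw [Fin.lt_def] at hlt ⊢; simp only; omega)
    rw [hr₀, Fin.lt_def] at h1
    rw [hr₁, Fin.lt_def] at h2
    omega
  have hwa : wt a I = wt b I + 1 := by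
    rw [wt_left hab, memSign, if_pos hb]; ring
  have hne : ∀ r ∈ ({r₀, r₁} : Finset (Fin k))ᶜ, elt I r ≠ a ∧ elt I r ≠ b := fun r hr => by
    simp only [Finset.mem_compl, Finset.mem_insert, Finset.mem_singleton, not_or] at hr
    exact ⟨fun h => hr.1 (elt_injective I (h.trans hr₀.symm)),
      fun h => hr.2 (elt_injective I (h.trans hr₁.symm))⟩
  rw [W_eq_sum, W_eq_sum]
  congr 1
  rw [← sub_eq_zero, ← Finset.sum_sub_distrib]
  refine Finset.sum_involution (fun τ _ => τ * Equiv.swap r₀ r₁) (fun τ _ => ?_)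
    (fun τ _ _ h => hlt.ne (Equiv.swap_eq_one_iff.1 (mul_eq_left.1 h)))
    (fun _ _ => Finset.mem_univ _) (fun τ _ => by simp [mul_assoc])
  have hrest : ∀ τ : Equiv.Perm (Fin k), ∏ r ∈ ({r₀, r₁} : Finset (Fin k))ᶜ,
      rowProd lam y (z ∘ Equiv.swap a b) (elt I r) (wt (elt I r) I) (t (τ r)) =
      ∏ r ∈ ({r₀, r₁} : Finset (Fin k))ᶜ,
        rowProd lam y z (elt I r) (wt (elt I r) I) (t (τ r)) := fun τ =>
    Finset.prod_congr rfl fun r hr => rowProd_swap hab _ _ _ (hne r hr).1 (hne r hr).2 _ _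
  have hrest' : ∏ r ∈ ({r₀, r₁} : Finset (Fin k))ᶜ,
      rowProd lam y z (elt I r) (wt (elt I r) I) (t ((τ * Equiv.swap r₀ r₁) r)) =
      ∏ r ∈ ({r₀, r₁} : Finset (Fin k))ᶜ,
        rowProd lam y z (elt I r) (wt (elt I r) I) (t (τ r)) :=
    Finset.prod_congr rfl fun r hr => by
      simp only [Finset.mem_compl, Finset.mem_insert, Finset.mem_singleton, not_or] at hr
      rw [Equiv.Perm.mul_apply, Equiv.swap_apply_of_ne_of_ne hr.1 hr.2]
  have hpair : pairRest y (t ∘ (τ * Equiv.swap r₀ r₁)) r₀ r₁ = pairRest y (t ∘ τ) r₀ r₁ :=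
    pairRest_swap y (t ∘ τ) hr
  simp only [prod_eq_mul_prod_compl_pair hlt.ne, hrest, hrest', pairProd_eq y _ hlt, hpair,
    hr₀, hr₁, rowProd_left hab, rowProd_right hab, rowRest_swap, hwa, Function.comp_apply,
    Equiv.swap_apply_left, Equiv.swap_apply_right]
  simp only [Equiv.Perm.mul_apply, Equiv.swap_apply_left, Equiv.swap_apply_right]
  generalize (∏ r ∈ ({r₀, r₁} : Finset (Fin k))ᶜ,
        rowProd lam y z (elt I r) (wt (elt I r) I) (t (τ r))) = P
  generalize pairRest y (t ∘ τ) r₀ r₁ = E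
  have h01 : t (τ r₀) - t (τ r₁) ≠ 0 :=
    sub_ne_zero.2 fun h => hlt.ne (τ.injective (ht h))
  have h10 : t (τ r₁) - t (τ r₀) ≠ 0 :=
    sub_ne_zero.2 fun h => hlt.ne' (τ.injective (ht h))
  generalize rowRest y z a b (t (τ r₀)) = A
  generalize rowRest y z a b (t (τ r₁)) = B
  generalize t (τ r₀) = u at *
  generalize t (τ r₁) = v at *
  -- Both terms of the pair are brought to the single denominator `u - v`.
  rw [← neg_sub u v, div_neg]
  push_cast
  field_simp
  ring

/-! ### Triangularity -/

/-- Row `r` contains the factor `x - z q` for every `q` beyond `elt I r`; it vanishes at `q = ι (τ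
r)`. -/
lemma W_term_eq_zero {I : Subsets n k} (lam : K) (z : Fin n → K) (y : K) (ι : Fin k → Fin n)
    (τ : Equiv.Perm (Fin k)) {r : Fin k} (hr : elt I r < ι (τ r)) :
    ∏ r, rowProd lam y z (elt I r) (wt (elt I r) I) (z (ι (τ r))) = 0 := by
  refine Finset.prod_eq_zero (Finset.mem_univ r) ?_
  refine Finset.prod_eq_zero (Finset.mem_univ (ι (τ r))) ?_
  rw [if_neg hr.not_gt, if_neg hr.ne', sub_self]

/-- Termwise inequality together with the reverse inequality of sums forces termwise equality. The
sum of elements thus serves as a linear substitute for the Bruhat-type partial order. -/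
lemma eq_of_comp_perm_le {I J : Subsets n k} {τ : Equiv.Perm (Fin k)}
    (h : ∀ r, elt I (τ r) ≤ elt J r) (hsum : ∑ j ∈ J.1, (j : ℕ) ≤ ∑ j ∈ I.1, (j : ℕ)) :
    ∀ r, elt I (τ r) = elt J r := by
  rw [← sum_elt J, ← sum_elt I, ← Equiv.sum_comp τ fun r => (elt I r : ℕ)] at hsum
  have h' : ∀ r ∈ Finset.univ, (elt I (τ r) : ℕ) ≤ elt J r := fun r _ => h r
  have := (Finset.sum_eq_sum_iff_of_le h').1 (le_antisymm (Finset.sum_le_sum h') hsum)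
  exact fun r => Fin.ext (this r (Finset.mem_univ r))

lemma W_elt_eq_zero {I J : Subsets n k} (hne : I ≠ J)
    (hsum : ∑ j ∈ J.1, (j : ℕ) ≤ ∑ j ∈ I.1, (j : ℕ)) (lam : K) (z : Fin n → K) (y : K) :
    W J lam (z ∘ elt I) z y = 0 := by
  rw [W_eq_sum]
  refine mul_eq_zero_of_right _ (Finset.sum_eq_zero fun τ _ => ?_)
  by_cases h : ∀ r, elt I (τ r) ≤ elt J r
  -- A nonvanishing term would give `I ⊆ J`, hence `I = J` by cardinality.
  · refine absurd (Subtype.ext (Finset.eq_of_subset_of_card_le (fun j hj => ?_) ?_)) hne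
    · obtain ⟨r, rfl⟩ := exists_elt_eq hj
      have := eq_of_comp_perm_le h hsum (τ⁻¹ r)
      rw [← Equiv.Perm.mul_apply, mul_inv_cancel, Equiv.Perm.one_apply] at this
      exact this ▸ elt_mem J _
    · rw [I.2, J.2]
  · push Not at h
    obtain ⟨r, hr⟩ := h
    exact mul_eq_zero_of_left (W_term_eq_zero lam z y (elt I) τ hr) _

/-- Only the summand `τ = 1` survives, and it is a product of nonzero factors. -/
lemma W_elt_self_ne_zero (I : Subsets n k) {lam y : K} {z : Fin n → K}
    (hy : y ≠ 0) (hz : Function.Injective z) (hzy : ∀ i j, z i - z j + y ≠ 0)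
    (hlam : ∀ c : ℤ, lam + c * y ≠ 0) :
    W I lam (z ∘ elt I) z y ≠ 0 := by
  rw [W_eq_sum, Finset.sum_eq_single 1]
  · refine mul_ne_zero (pow_ne_zero _ hy) (mul_ne_zero ?_ ?_)
    · refine Finset.prod_ne_zero_iff.2 fun r _ => Finset.prod_ne_zero_iff.2 fun q _ => ?_
      simp only [Equiv.Perm.one_apply, Function.comp_apply]
      split_ifs with h1 h2
      · exact hzy _ _
      · have := hlam (-wt (elt I r) I)
        push_cast at this
        rw [h2]
        intro h
        apply this
        linear_combination h
      · exact sub_ne_zero.2 fun h => h2 (hz h).symm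
    · refine Finset.prod_ne_zero_iff.2 fun r _ => Finset.prod_ne_zero_iff.2 fun s hs => ?_
      refine div_ne_zero (hzy _ _) (sub_ne_zero.2 fun h => ?_)
      exact (Finset.mem_Ioi.1 hs).ne (elt_injective I (hz h))
  · intro τ _ hτ
    by_cases h : ∀ r, elt I (τ r) ≤ elt I r
    · exact absurd (Equiv.ext fun r => elt_injective I (eq_of_comp_perm_le h le_rfl r)) hτ
    · push Not at h
      obtain ⟨r, hr⟩ := h
      exact mul_eq_zero_of_left (W_term_eq_zero lam z y (elt I) τ hr) _
  · exact fun h => absurd (Finset.mem_univ _) h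

end WeightFunctions

/-! ### Modified weight functions -/

/-- The sequence of basis indices of `v_J`. -/
def ind {n : ℕ} (J : Finset (Fin n)) : Fin n → Fin 2 := fun j => if j ∈ J then 0 else 1

section DynR

variable {K : Type*} [Field K] (lam z y : K)

lemma dynR_01_01 : dynR lam z y (0, 1) (0, 1) = (lam + y) * z / (lam * (z - y)) := rfl
lemma dynR_01_10 : dynR lam z y (0, 1) (1, 0) = -((lam + z) * y) / (lam * (z - y)) := rfl
lemma dynR_10_01 : dynR lam z y (1, 0) (0, 1) = -((lam - z) * y) / (lam * (z - y)) := rfl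
lemma dynR_10_10 : dynR lam z y (1, 0) (1, 0) = (lam - y) * z / (lam * (z - y)) := rfl

end DynR

section ModifiedWeight

variable {K : Type*} [Field K] {n k : ℕ} {a b : Fin n}

lemma eK_comp_perm (t : Fin k → K) (y : K) (π : Equiv.Perm (Fin k)) :
    eK (t ∘ π) y = eK t y := by
  exact (Finset.prod_congr rfl fun r _ => Equiv.prod_comp π fun s => t (π r) - t s + y).trans
    (Equiv.prod_comp π fun r => ∏ s, (t r - t s + y))

lemma WMinus_comp_perm (J : Subsets n k) (lam : K) (t : Fin k → K) (z : Fin n → K) (y : K)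
    (π : Equiv.Perm (Fin k)) : WMinus J lam (t ∘ π) z y = WMinus J lam t z y := by
  rw [WMinus, WMinus, eK_comp_perm, WPerm, WPerm, W_comp_perm]

/-- The image of a subset under the longest permutation. -/
def revSubset (J : Subsets n k) : Subsets n k := permSubset Fin.revPerm⁻¹ J

lemma mem_revSubset (J : Subsets n k) (j : Fin n) : j ∈ (revSubset J).1 ↔ j.rev ∈ J.1 := by
  rw [revSubset, mem_permSubset, inv_inv, Fin.revPerm_apply]

lemma revSubset_injective : Function.Injective (revSubset (n := n) (k := k)) := fun I J h => by
  ext j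
  have := mem_revSubset I j.rev
  rw [h, mem_revSubset, Fin.rev_rev] at this
  exact this.symm

lemma WMinus_eq (J : Subsets n k) (lam : K) (t : Fin k → K) (z : Fin n → K) (y : K) :
    WMinus J lam t z y = (-1) ^ k / eK t y *
      W (revSubset J) (-lam - ((n : K) - 2 * (k : K)) * y) t (z ∘ Fin.rev) y := rfl

lemma swap_rev (a b j : Fin n) :
    Equiv.swap b.rev a.rev j = (Equiv.swap a b j.rev).rev := by
  simp only [Equiv.swap_apply_def]
  split_ifs <;> simp_all [Fin.rev_eq_iff]

lemma comp_swap_comp_rev {α : Type*} (z : Fin n → α) (a b : Fin n) :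
    (z ∘ Equiv.swap a b) ∘ Fin.rev = (z ∘ Fin.rev) ∘ Equiv.swap b.rev a.rev := by
  ext j
  simp [swap_rev]

lemma revSubset_permSubset_swap (a b : Fin n) (J : Subsets n k) :
    revSubset (permSubset (Equiv.swap a b) J) =
      permSubset (Equiv.swap b.rev a.rev) (revSubset J) := by
  ext j
  simp [mem_revSubset, mem_permSubset, swap_rev]

lemma rev_succ (hab : (a : ℕ) + 1 = b) : (b.rev : ℕ) + 1 = a.rev := by
  simp only [Fin.val_rev]
  omega

/-- The total weight of the positions to the right of `a` and `a + 1`. -/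
def rightWt (a : Fin n) (J : Subsets n k) : ℤ :=
  ∑ m ∈ Finset.univ.filter (fun m : Fin n => (a : ℕ) + 2 ≤ m), memSign J m

/-- After reversal the weight counts positions to the left of `a`. The total weight is `2k - n` and
`a, b` cancel, so the left weight is `2k - n` minus the right weight. This is why the shift `-λ - (n
- 2k) y` turns into `-(λ - y * rightWt a J)`, matching the dynamical argument of `R`. -/
lemma wt_rev (hab : (a : ℕ) + 1 = b) (J : Subsets n k) (h : memSign J a + memSign J b = 0) :
    wt a.rev (revSubset J) = 2 * k - n - rightWt a J := by
  have h1 : wt a.rev (revSubset J) = ∑ j, if j < a then memSign J j else 0 := by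
    rw [wt_eq_sum, ← Equiv.sum_comp Fin.revPerm]
    refine Finset.sum_congr rfl fun j _ => ?_
    simp only [Fin.revPerm_apply, Fin.rev_lt_rev, memSign, mem_revSubset, Fin.rev_rev]
  have hne : a ≠ b := fun h => by rw [h] at hab; omega
  have h2 : ∑ j, memSign J j = (∑ j, if j < a then memSign J j else 0) + rightWt a J +
      ∑ j ∈ {a, b}, memSign J j := by
    rw [rightWt, Finset.sum_filter, ← Finset.sum_add_distrib,
      ← Finset.sum_filter_add_sum_filter_not (s := Finset.univ)
        (p := fun j => j ∈ ({a, b} : Finset (Fin n))),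
      add_comm, Finset.filter_mem_eq_inter, Finset.univ_inter]
    congr 1
    rw [Finset.sum_filter]
    refine Finset.sum_congr rfl fun j _ => ?_
    simp only [Finset.mem_insert, Finset.mem_singleton, Fin.ext_iff, Fin.lt_def]
    split_ifs <;> omega
  rw [sum_memSign, Finset.sum_pair hne, h] at h2
  rw [h1]
  omega

lemma WMinus_swap_eq (hab : (a : ℕ) + 1 = b) {J : Subsets n k} (h : a ∈ J.1 ↔ b ∈ J.1)
    (lam : K) {t : Fin k → K} (ht : Function.Injective t) (z : Fin n → K) (y : K) :
    WMinus J lam t (z ∘ Equiv.swap a b) y = WMinus J lam t z y := by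
  rw [WMinus_eq, WMinus_eq, comp_swap_comp_rev]
  congr 1
  by_cases hb : b ∈ J.1
  · exact W_swap_of_mem (rev_succ hab) (by simpa [mem_revSubset] using hb)
      (by simpa [mem_revSubset] using h.2 hb) _ ht _ _
  · exact W_swap_of_notMem (rev_succ hab) (by simpa [mem_revSubset] using hb)
      (by simpa [mem_revSubset] using fun h' => hb (h.1 h')) _ _ _ _

lemma WMinus_swap_linear (hab : (a : ℕ) + 1 = b) {J : Subsets n k} (ha : a ∉ J.1) (hb : b ∈ J.1)
    (lam : K) (t : Fin k → K) (z : Fin n → K) (y : K) (c₁ c₂ c₃ c₄ m : K)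
    (hm : m = lam - y * rightWt a J)
    (h : ∀ x, c₁ * ((-m + x - z b + y) * (x - z a)) + c₂ * ((-m + x - z a + y) * (x - z b)) +
      c₃ * ((x - z b + y) * (-m + x - z a)) + c₄ * ((x - z a + y) * (-m + x - z b)) = 0) :
    c₁ * WMinus J lam t z y + c₂ * WMinus J lam t (z ∘ Equiv.swap a b) y +
      c₃ * WMinus (permSubset (Equiv.swap a b) J) lam t z y +
      c₄ * WMinus (permSubset (Equiv.swap a b) J) lam t (z ∘ Equiv.swap a b) y = 0 := by
  have key := W_swap_linear (rev_succ hab) (I := revSubset J)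
    (by simpa [mem_revSubset] using hb) (by simpa [mem_revSubset] using ha)
    (-lam - ((n : K) - 2 * (k : K)) * y) t (z ∘ Fin.rev) y c₁ c₂ c₃ c₄ (-m) (by
      rw [wt_rev hab J (by simp [memSign, ha, hb]), hm]; push_cast; ring)
    (by simpa only [Function.comp_apply, Fin.rev_rev] using h)
  simp only [WMinus_eq, comp_swap_comp_rev, revSubset_permSubset_swap]
  linear_combination ((-1) ^ k / eK t y) * key

lemma permSubset_swap_swap (a b : Fin n) (J : Subsets n k) :
    permSubset (Equiv.swap a b) (permSubset (Equiv.swap a b) J) = J := by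
  ext j; simp [mem_permSubset]

lemma rightWt_permSubset_swap (hab : (a : ℕ) + 1 = b) (J : Subsets n k) :
    rightWt a (permSubset (Equiv.swap a b) J) = rightWt a J := by
  refine Finset.sum_congr rfl fun j hj => ?_
  rw [Finset.mem_filter] at hj
  rw [memSign_permSubset, Equiv.swap_inv, Equiv.swap_apply_of_ne_of_ne] <;>
  · rintro rfl; omega

/-- The coefficients of the vectors `ξ_I` satisfy the relation given by the `R`-matrix. -/
lemma WMinus_eq_dynR (hab : (a : ℕ) + 1 = b) {J : Subsets n k} (h : ¬(a ∈ J.1 ↔ b ∈ J.1))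
    (lam : K) (t : Fin k → K) (z : Fin n → K) (y : K)
    (hm : lam - y * rightWt a J ≠ 0) (hz : z a - z b - y ≠ 0) :
    WMinus J lam t z y =
      dynR (lam - y * rightWt a J) (z a - z b) y (ind J.1 a, ind J.1 b) (ind J.1 a, ind J.1 b) *
          WMinus (permSubset (Equiv.swap a b) J) lam t (z ∘ Equiv.swap a b) y +
        dynR (lam - y * rightWt a J) (z a - z b) y (ind J.1 a, ind J.1 b) (ind J.1 b, ind J.1 a) *
          WMinus J lam t (z ∘ Equiv.swap a b) y := by
  by_cases hb : b ∈ J.1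
  · have ha : a ∉ J.1 := fun ha => h ⟨fun _ => hb, fun _ => ha⟩
    simp only [ind, if_pos hb, if_neg ha, dynR_10_10, dynR_10_01]
    have key := WMinus_swap_linear hab ha hb lam t z y (-1)
      (-((lam - y * rightWt a J - (z a - z b)) * y) /
        ((lam - y * rightWt a J) * (z a - z b - y))) 0
      ((lam - y * rightWt a J - y) * (z a - z b) / ((lam - y * rightWt a J) * (z a - z b - y)))
      _ rfl (fun x => by field_simp; ring)
    linear_combination -key
  · have ha : a ∈ J.1 := by tauto
    -- Here `J` contains `a` and not `b`, so the relation is applied to the swapped subset, which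
    -- has the required form.
    have h1 := WMinus_swap_linear hab (J := permSubset (Equiv.swap a b) J)
      (by simpa [mem_permSubset] using hb) (by simpa [mem_permSubset] using ha) lam t z y 0
      ((lam - y * rightWt a J + y) * (z a - z b) / ((lam - y * rightWt a J) * (z a - z b - y)))
      (-1)
      (-((lam - y * rightWt a J + (z a - z b)) * y) /
        ((lam - y * rightWt a J) * (z a - z b - y))) (lam - y * rightWt a J)
      (by rw [rightWt_permSubset_swap hab]) (fun x => by field_simp; ring)
    rw [permSubset_swap_swap] at h1
    simp only [ind, if_neg hb, if_pos ha, dynR_01_10, dynR_01_01]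
    linear_combination -h1

lemma comp_elt_eq (I : Subsets n k) {α : Type*} (z : Fin n → α) :
    ∃ π : Equiv.Perm (Fin k), z ∘ elt I = ((z ∘ Fin.rev) ∘ elt (revSubset I)) ∘ π := by
  obtain ⟨π, hπ⟩ := exists_perm_comp_elt Fin.revPerm⁻¹ I
  refine ⟨π, ?_⟩
  rw [Function.comp_assoc, revSubset, ← hπ, ← Function.comp_assoc]
  congr 1
  ext j
  exact congrArg z (Fin.rev_rev j).symm

lemma WMinus_elt_eq_zero {I J : Subsets n k} (hne : I ≠ J)
    (hsum : ∑ j ∈ (revSubset J).1, (j : ℕ) ≤ ∑ j ∈ (revSubset I).1, (j : ℕ))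
    (lam : K) (z : Fin n → K) (y : K) : WMinus J lam (z ∘ elt I) z y = 0 := by
  obtain ⟨π, hπ⟩ := comp_elt_eq I z
  rw [hπ, WMinus_comp_perm, WMinus_eq,
    W_elt_eq_zero (fun h => hne (revSubset_injective h)) hsum, mul_zero]

lemma WMinus_elt_self_ne_zero (I : Subsets n k) {lam y : K} {z : Fin n → K}
    (hy : y ≠ 0) (hz : Function.Injective z) (hzy : ∀ i j, z i - z j + y ≠ 0)
    (hlam : ∀ c : ℤ, lam + c * y ≠ 0) :
    WMinus I lam (z ∘ elt I) z y ≠ 0 := by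
  obtain ⟨π, hπ⟩ := comp_elt_eq I z
  rw [hπ, WMinus_comp_perm, WMinus_eq]
  refine mul_ne_zero (div_ne_zero (pow_ne_zero _ (neg_ne_zero.2 one_ne_zero)) ?_)
    (W_elt_self_ne_zero _ hy (hz.comp Fin.rev_injective) (fun _ _ => hzy _ _) fun c h => ?_)
  · exact Finset.prod_ne_zero_iff.2 fun r _ => Finset.prod_ne_zero_iff.2 fun s _ => hzy _ _
  -- The shift by `(n - 2k) y` keeps the parameter, up to sign, in the family `λ + c y`.
  · have := hlam ((n - 2 * k : ℤ) - c)
    push_cast at this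
    apply this
    linear_combination -h

lemma Q_permSubset (σ : Equiv.Perm (Fin n)) (I : Subsets n k) (z : Fin n → K) (y : K) :
    Q (permSubset σ I) z y = Q I (z ∘ σ) y := by
  have : (permSubset σ I).1ᶜ = I.1ᶜ.map σ.toEmbedding := by
    ext j
    simp [mem_permSubset, Finset.mem_map_equiv]
  rw [Q, Q, this]
  simp [permSubset, Finset.prod_map]

/-! ### Compatibility of the weight functions with field homomorphisms -/

variable {K' : Type*} [Field K'] (φ : K →+* K')

lemma map_WMinus (J : Subsets n k) (lam : K) (t : Fin k → K) (z : Fin n → K) (y : K) :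
    φ (WMinus J lam t z y) = WMinus J (φ lam) (φ ∘ t) (φ ∘ z) (φ y) := by
  have hl : ∀ (I : Subsets n k) (lam : K) (t : Fin k → K) (z : Fin n → K) (r : Fin k) (q : Fin n),
      φ (lFactor I lam t z y r q) = lFactor I (φ lam) (φ ∘ t) (φ ∘ z) (φ y) r q := by
    intro I lam t z r q
    simp only [lFactor, apply_ite φ]
    simp
  simp only [WMinus, WPerm, W, eK, map_mul, map_div₀, map_sum, map_prod, hl]
  have h2 : φ 2 = 2 := map_ofNat φ 2
  simp [Function.comp_assoc, h2]

lemma map_Q (J : Subsets n k) (z : Fin n → K) (y : K) :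
    φ (Q J z y) = Q J (φ ∘ z) (φ y) := by
  simp [Q, map_prod]

end ModifiedWeight

/-! ### Rational functions and the permutations of the variables -/

section RationalFunctions

variable {n : ℕ}

lemma mem_L {x : F n} : x ∈ L n ↔ ∃ p q : MvPolynomial (Var n) ℂ, q ∈ denoms n ∧
    x = algebraMap _ (F n) p * (algebraMap _ (F n) q)⁻¹ := by
  refine Iff.trans (b := ∃ (a s : MvPolynomial (Var n) ℂ) (_ : s ∈ denoms n),
    x = algebraMap _ (F n) a * (algebraMap _ (F n) s)⁻¹) Iff.rfl ?_
  simp only [exists_prop]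

lemma algebraMap_mem_L (p : MvPolynomial (Var n) ℂ) : algebraMap _ (F n) p ∈ L n :=
  mem_L.2 ⟨p, 1, one_mem _, by simp⟩

lemma inv_mem_L {q : MvPolynomial (Var n) ℂ} (hq : q ∈ denoms n) :
    (algebraMap _ (F n) q)⁻¹ ∈ L n :=
  mem_L.2 ⟨1, q, hq, by simp⟩

lemma algebraMap_ne_zero {q : MvPolynomial (Var n) ℂ} (hq : q ∈ denoms n) :
    algebraMap _ (F n) q ≠ 0 :=
  IsFractionRing.to_map_ne_zero_of_mem_nonZeroDivisors (denoms_le n hq)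

lemma lam_add_mem (l : ℤ) : (MvPolynomial.X Var.lam +
    (l : MvPolynomial (Var n) ℂ) * MvPolynomial.X Var.y) ∈ denoms n :=
  Submonoid.subset_closure (Or.inl (Or.inl ⟨l, rfl⟩))

lemma z_sub_mem {i j : Fin n} (h : i ≠ j) : (MvPolynomial.X (Var.z i) -
    MvPolynomial.X (Var.z j) : MvPolynomial (Var n) ℂ) ∈ denoms n :=
  Submonoid.subset_closure (Or.inl (Or.inr ⟨i, j, h, rfl⟩))

lemma z_sub_sub_mem (i j : Fin n) : (MvPolynomial.X (Var.z i) -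
    MvPolynomial.X (Var.z j) - MvPolynomial.X Var.y : MvPolynomial (Var n) ℂ) ∈ denoms n :=
  Submonoid.subset_closure (Or.inr ⟨i, j, rfl⟩)

lemma map_lam_add (l : ℤ) : algebraMap _ (F n) (MvPolynomial.X Var.lam +
    (l : MvPolynomial (Var n) ℂ) * MvPolynomial.X Var.y) = lamF n + l * yF n := by
  simp [lamF, yF, X]

lemma map_z_sub (i j : Fin n) : algebraMap _ (F n) (MvPolynomial.X (Var.z i) -
    MvPolynomial.X (Var.z j) : MvPolynomial (Var n) ℂ) = zF n i - zF n j := by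
  simp [zF, X]

lemma map_z_sub_sub (i j : Fin n) : algebraMap _ (F n) (MvPolynomial.X (Var.z i) -
    MvPolynomial.X (Var.z j) - MvPolynomial.X Var.y : MvPolynomial (Var n) ℂ) =
      zF n i - zF n j - yF n := by
  simp [zF, yF, X]

lemma lam_add_ne_zero (l : ℤ) : lamF n + l * yF n ≠ 0 :=
  map_lam_add (n := n) l ▸ algebraMap_ne_zero (lam_add_mem l)

lemma z_sub_sub_ne_zero (i j : Fin n) : zF n i - zF n j - yF n ≠ 0 :=
  map_z_sub_sub i j ▸ algebraMap_ne_zero (z_sub_sub_mem i j)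

lemma z_sub_add_ne_zero (i j : Fin n) : zF n i - zF n j + yF n ≠ 0 := fun h =>
  z_sub_sub_ne_zero j i (by linear_combination -h)

lemma zF_injective : Function.Injective (zF n) := fun i j h => by
  by_contra hne
  exact (map_z_sub i j ▸ algebraMap_ne_zero (z_sub_mem hne)) (sub_eq_zero.2 h)

lemma yF_ne_zero : yF n ≠ 0 :=
  IsFractionRing.to_map_ne_zero_of_mem_nonZeroDivisors
    (mem_nonZeroDivisors_of_ne_zero (MvPolynomial.X_ne_zero _))

lemma lamF_mem : lamF n ∈ L n := algebraMap_mem_L _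

lemma yF_mem : yF n ∈ L n := algebraMap_mem_L _

lemma zF_mem (i : Fin n) : zF n i ∈ L n := algebraMap_mem_L _

lemma inv_lam_add_mem (l : ℤ) : (lamF n + l * yF n)⁻¹ ∈ L n :=
  map_lam_add (n := n) l ▸ inv_mem_L (lam_add_mem l)

lemma inv_z_sub_mem {i j : Fin n} (h : i ≠ j) : (zF n i - zF n j)⁻¹ ∈ L n :=
  map_z_sub i j ▸ inv_mem_L (z_sub_mem h)

lemma inv_z_sub_sub_mem (i j : Fin n) : (zF n i - zF n j - yF n)⁻¹ ∈ L n :=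
  map_z_sub_sub i j ▸ inv_mem_L (z_sub_sub_mem i j)

/-- The case `i = j` is included and says that `y` is invertible in `L`; the diagonal factors of
`e_k` need it. -/
lemma inv_z_sub_add_mem (i j : Fin n) : (zF n i - zF n j + yF n)⁻¹ ∈ L n := by
  have : zF n i - zF n j + yF n = -(zF n j - zF n i - yF n) := by ring
  have h : (zF n i - zF n j + yF n)⁻¹ = -(zF n j - zF n i - yF n)⁻¹ := by
    rw [this]; exact inv_neg
  rw [h]
  exact neg_mem (inv_z_sub_sub_mem j i)

lemma intCast_mem_L (c : ℤ) : (c : F n) ∈ L n := intCast_mem _ c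

lemma dynR_mem_L (c : ℤ) (i j : Fin n) (p q : Fin 2 × Fin 2) :
    dynR (lamF n - yF n * c) (zF n i - zF n j) (yF n) p q ∈ L n := by
  have hm : lamF n - yF n * c ∈ L n :=
    sub_mem lamF_mem (mul_mem yF_mem (intCast_mem_L c))
  have hz : zF n i - zF n j ∈ L n := sub_mem (zF_mem i) (zF_mem j)
  have hinv : ((lamF n - yF n * c) * (zF n i - zF n j - yF n))⁻¹ ∈ L n := by
    have h := inv_lam_add_mem (n := n) (-c)
    have h2 : lamF n + ((-c : ℤ) : F n) * yF n = lamF n - yF n * c := by push_cast; ring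
    rw [h2] at h
    rw [mul_inv]
    exact mul_mem h (inv_z_sub_sub_mem i j)
  obtain ⟨p₁, p₂⟩ := p
  obtain ⟨q₁, q₂⟩ := q
  fin_cases p₁ <;> fin_cases p₂ <;> fin_cases q₁ <;> fin_cases q₂ <;>
    first
    | exact zero_mem (L n)
    | exact one_mem (L n)
    | exact mul_mem (mul_mem (add_mem hm yF_mem) hz) hinv
    | exact mul_mem (mul_mem (sub_mem hm yF_mem) hz) hinv
    | exact mul_mem (neg_mem (mul_mem (add_mem hm hz) yF_mem)) hinv
    | exact mul_mem (neg_mem (mul_mem (sub_mem hm hz) yF_mem)) hinv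

lemma substZ_algebraMap (σ : Equiv.Perm (Fin n)) (p : MvPolynomial (Var n) ℂ) :
    substZ σ (algebraMap _ (F n) p) = algebraMap _ (F n) (MvPolynomial.rename (permVar σ) p) := by
  rw [substZ, IsFractionRing.algEquivOfAlgEquiv_algebraMap]
  rfl

lemma substZ_lamF (σ : Equiv.Perm (Fin n)) : substZ σ (lamF n) = lamF n := by
  rw [lamF, X, substZ_algebraMap, MvPolynomial.rename_X]; rfl

lemma substZ_yF (σ : Equiv.Perm (Fin n)) : substZ σ (yF n) = yF n := by
  rw [yF, X, substZ_algebraMap, MvPolynomial.rename_X]; rfl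

lemma substZ_zF (σ : Equiv.Perm (Fin n)) (i : Fin n) : substZ σ (zF n i) = zF n (σ i) := by
  rw [zF, X, substZ_algebraMap, MvPolynomial.rename_X]; rfl

lemma substZ_mul (σ τ : Equiv.Perm (Fin n)) (x : F n) :
    substZ (σ * τ) x = substZ σ (substZ τ x) := by
  obtain ⟨p, q, -, rfl⟩ := IsFractionRing.div_surjective (MvPolynomial (Var n) ℂ) x
  have : (permVar (σ * τ) : Var n → Var n) = permVar σ ∘ permVar τ := by
    ext v; cases v <;> rfl
  simp only [map_div₀, substZ_algebraMap, MvPolynomial.rename_rename, this]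

lemma substZ_one (x : F n) : substZ 1 x = x := by
  obtain ⟨p, q, -, rfl⟩ := IsFractionRing.div_surjective (MvPolynomial (Var n) ℂ) x
  have : (permVar (1 : Equiv.Perm (Fin n)) : Var n → Var n) = id := by
    ext v; cases v <;> rfl
  simp only [map_div₀, substZ_algebraMap, this, MvPolynomial.rename_id_apply]

lemma rename_mem_denoms (σ : Equiv.Perm (Fin n)) {q : MvPolynomial (Var n) ℂ}
    (hq : q ∈ denoms n) : MvPolynomial.rename (permVar σ) q ∈ denoms n := by
  have : denoms n ≤ (denoms n).comap (MvPolynomial.rename (permVar σ)) := by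
    refine Submonoid.closure_le.2 ?_
    rintro p ((⟨l, rfl⟩ | ⟨i, j, hij, rfl⟩) | ⟨i, j, rfl⟩) <;>
      simp only [SetLike.mem_coe, Submonoid.mem_comap, map_add, map_sub, map_mul, map_intCast,
        MvPolynomial.rename_X]
    · exact lam_add_mem l
    · exact z_sub_mem (σ.injective.ne hij)
    · exact z_sub_sub_mem (σ i) (σ j)
  exact this hq

lemma substZ_mem_L (σ : Equiv.Perm (Fin n)) {x : F n} (hx : x ∈ L n) : substZ σ x ∈ L n := by
  obtain ⟨p, q, hq, rfl⟩ := mem_L.1 hx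
  exact mem_L.2 ⟨_, _, rename_mem_denoms σ hq, by
    rw [map_mul, map_inv₀, substZ_algebraMap, substZ_algebraMap]⟩

lemma div_mem_L {x d : F n} (hx : x ∈ L n) (hd : d⁻¹ ∈ L n) : x / d ∈ L n :=
  div_eq_mul_inv x d ▸ mul_mem hx hd

lemma W_mem_L {k : ℕ} (I : Subsets n k) {lam y : F n} {t : Fin k → F n} {z : Fin n → F n}
    (hlam : lam ∈ L n) (hy : y ∈ L n) (ht : ∀ r, t r ∈ L n) (hz : ∀ i, z i ∈ L n)
    (hinv : ∀ r s, r ≠ s → (t r - t s)⁻¹ ∈ L n) : W I lam t z y ∈ L n := by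
  refine mul_mem (pow_mem hy _) (sum_mem fun τ _ => mul_mem ?_ ?_)
  · refine prod_mem fun r _ => prod_mem fun q _ => ?_
    unfold lFactor
    split_ifs
    · exact add_mem (sub_mem (ht _) (hz _)) hy
    · exact sub_mem (sub_mem (add_mem hlam (ht _)) (hz _)) (mul_mem (intCast_mem_L _) hy)
    · exact sub_mem (ht _) (hz _)
  · refine prod_mem fun r _ => prod_mem fun s hs => div_mem_L
      (add_mem (sub_mem (ht _) (ht _)) hy) (hinv _ _ (τ.injective.ne (Finset.mem_Ioi.1 hs).ne))

lemma WMinus_mem_L {k : ℕ} (I J : Subsets n k) :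
    WMinus J (lamF n) (zF n ∘ elt I) (zF n) (yF n) ∈ L n := by
  refine mul_mem (div_mem_L (pow_mem (neg_mem (one_mem _)) _) ?_)
    (W_mem_L _ ?_ yF_mem (fun _ => zF_mem _) (fun _ => zF_mem _)
      fun r s h => inv_z_sub_mem ((elt_injective I).ne h))
  · rw [eK, ← Finset.prod_inv_distrib]
    refine prod_mem fun r _ => ?_
    rw [← Finset.prod_inv_distrib]
    exact prod_mem fun s _ => inv_z_sub_add_mem _ _
  · have h2 : ((n - 2 * k : ℤ) : F n) ∈ L n := intCast_mem_L _
    push_cast at h2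
    exact sub_mem (neg_mem lamF_mem) (mul_mem h2 yF_mem)

lemma inv_Q_mem_L {k : ℕ} (I : Subsets n k) : (Q I (zF n) (yF n))⁻¹ ∈ L n := by
  rw [Q, ← Finset.prod_inv_distrib]
  refine prod_mem fun r _ => ?_
  rw [← Finset.prod_inv_distrib]
  exact prod_mem fun s _ => inv_z_sub_add_mem _ _

lemma Q_ne_zero {k : ℕ} (I : Subsets n k) : Q I (zF n) (yF n) ≠ 0 :=
  Finset.prod_ne_zero_iff.2 fun _ _ => Finset.prod_ne_zero_iff.2 fun _ _ => z_sub_add_ne_zero _ _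

end RationalFunctions

/-! ### The operators in coordinates -/

section Coordinates

variable {n : ℕ}

lemma repr_tmul (f : F n) (c : C2pow n) (w : Fin n → Fin 2) :
    (vBasis n).repr (f ⊗ₜ[ℂ] c) w = f * algebraMap ℂ (F n)
      ((Basis.piTensorProduct fun _ : Fin n => Pi.basisFun ℂ (Fin 2)).repr c w) := by
  rw [vBasis, Algebra.TensorProduct.basis_repr_tmul]
  rfl

lemma smul_vBasis (f : F n) (w : Fin n → Fin 2) :
    f • vBasis n w = f ⊗ₜ[ℂ] (⨂ₜ[ℂ] j, (Pi.single (w j) 1 : Fin 2 → ℂ)) := by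
  rw [vBasis_apply, TensorProduct.smul_tmul', smul_eq_mul, mul_one]

lemma smul_vBasis_mem_lattice {f : F n} (hf : f ∈ L n) (w : Fin n → Fin 2) :
    f • vBasis n w ∈ lattice n := by
  rw [smul_vBasis]
  exact ⟨(⟨f, hf⟩ : L n) ⊗ₜ _, rfl⟩

lemma mem_lattice_iff {v : V n} : v ∈ lattice n ↔ ∀ w, (vBasis n).repr v w ∈ L n := by
  refine ⟨?_, fun h => ?_⟩
  · rintro ⟨u, rfl⟩ w
    induction u with
    | zero => simp
    | tmul f c =>
      rw [LinearMap.rTensor_tmul, repr_tmul]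
      exact mul_mem f.2 (Subalgebra.algebraMap_mem _ _)
    | add u v hu hv =>
      rw [map_add, map_add]
      exact add_mem hu hv
  · rw [← (vBasis n).sum_repr v]
    exact sum_mem fun w _ => smul_vBasis_mem_lattice (h w) w

lemma substV_smul_vBasis (σ : Equiv.Perm (Fin n)) (f : F n) (w : Fin n → Fin 2) :
    substV σ (f • vBasis n w) = substZ σ f • vBasis n w := by
  rw [smul_vBasis, smul_vBasis]
  rfl

lemma permFactors_smul_vBasis (σ : Equiv.Perm (Fin n)) (f : F n) (w : Fin n → Fin 2) :
    permFactors σ (f • vBasis n w) = f • vBasis n (w ∘ σ.symm) := by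
  rw [smul_vBasis, smul_vBasis, permFactors, LinearMap.lTensor_tmul]
  congr 1
  exact PiTensorProduct.reindex_tprod _ _

/-- The total weight of the tensor factors in positions `≥ i + 2`. -/
def tailWt (i : ℕ) (w : Fin n → Fin 2) : ℤ :=
  ∑ m ∈ Finset.univ.filter (fun m : Fin n => i + 2 ≤ (m : ℕ)), hwt (w m)

lemma sum_dynR_smul {K M : Type*} [Field K] [AddCommGroup M] [Module K M] (l x y : K)
    (i j : Fin 2) (g : Fin 2 × Fin 2 → M) :
    ∑ p, dynR l x y p (i, j) • g p = if i = j then g (i, j) else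
      dynR l x y (i, j) (i, j) • g (i, j) + dynR l x y (j, i) (i, j) • g (j, i) := by
  fin_cases i <;> fin_cases j <;>
    simp [Fintype.sum_prod_type, dynR, finProdFinEquiv, add_comm]

lemma RAt_vBasis {a b : Fin n} (hab : a ≠ b) (S : Finset (Fin n)) (x : F n)
    (u : Fin n → Fin 2) :
    RAt a b S x (vBasis n u) = if u a = u b then vBasis n u else
      dynR (lamF n - yF n * ∑ m ∈ S, (hwt (u m) : F n)) x (yF n) (u a, u b) (u a, u b) •
          vBasis n u +
        dynR (lamF n - yF n * ∑ m ∈ S, (hwt (u m) : F n)) x (yF n) (u b, u a) (u a, u b) •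
          vBasis n (u ∘ Equiv.swap a b) := by
  have hself : Function.update (Function.update u a (u a)) b (u b) = u := by simp
  have hswap : Function.update (Function.update u a (u b)) b (u a) = u ∘ Equiv.swap a b := by
    rw [Equiv.comp_swap_eq_update, Function.update_comm hab]
  rw [RAt, Module.Basis.constr_basis]
  refine (sum_dynR_smul _ _ _ (u a) (u b)
    fun p => vBasis n (Function.update (Function.update u a p.1) b p.2)).trans ?_
  rw [hself, hswap]

end Coordinates

/-! ### Coordinates and semilinearity of the operators `sTilde` -/

section Operators

variable {n : ℕ}

/-- The operators are only semilinear over `F n`, so all multiples of basis vectors must be tested.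
-/
lemma V_induction {P : V n → Prop} (h0 : P 0) (hadd : ∀ u v, P u → P v → P (u + v))
    (hsmul : ∀ (f : F n) w, P (f • vBasis n w)) (v : V n) : P v := by
  rw [← (vBasis n).sum_repr v]
  exact Finset.sum_induction _ P hadd h0 fun w _ => hsmul _ _

lemma repr_smul_vBasis (f : F n) (u w : Fin n → Fin 2) :
    (vBasis n).repr (f • vBasis n u) w = if u = w then f else 0 := by
  rw [map_smul, Module.Basis.repr_self, Finsupp.smul_single, smul_eq_mul, mul_one,
    Finsupp.single_apply]

lemma comp_swap_eq_self {α β : Type*} [DecidableEq α] {a b : α} {w : α → β} (h : w a = w b) :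
    w ∘ Equiv.swap a b = w := by
  ext j
  rw [Function.comp_apply, Equiv.swap_apply_def]
  split_ifs with h1 h2
  · rw [h1, h]
  · rw [h2, h]
  · rfl

lemma comp_swap_comp_swap {α β : Type*} [DecidableEq α] (a b : α) (w : α → β) :
    (w ∘ Equiv.swap a b) ∘ Equiv.swap a b = w := by
  ext j
  simp

lemma tailWt_comp_simpleRefl {i : ℕ} (hi : i + 1 < n) (w : Fin n → Fin 2) :
    tailWt i (w ∘ simpleRefl i hi) = tailWt i w := by
  refine Finset.sum_congr rfl fun m hm => ?_
  rw [Finset.mem_filter] at hm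
  rw [Function.comp_apply, simpleRefl, Equiv.swap_apply_of_ne_of_ne] <;>
  · rintro rfl
    simp only at hm
    omega

lemma sTilde_smul_vBasis {i : ℕ} (hi : i + 1 < n) (f : F n) (w : Fin n → Fin 2) :
    sTilde i hi (f • vBasis n w) = substZ (simpleRefl i hi) f •
      RAt ⟨i, by omega⟩ ⟨i + 1, hi⟩ (Finset.univ.filter fun m : Fin n => i + 2 ≤ (m : ℕ))
        (zF n ⟨i, by omega⟩ - zF n ⟨i + 1, hi⟩) (vBasis n (w ∘ simpleRefl i hi)) := by
  rw [sTilde, LinearMap.comp_apply, LinearMap.comp_apply, substV_smul_vBasis,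
    permFactors_smul_vBasis, LinearMap.restrictScalars_apply, map_smul]
  rfl

/-- The operator `s̃_i` in coordinates. -/
lemma repr_sTilde {i : ℕ} (hi : i + 1 < n) (v : V n) (w : Fin n → Fin 2) {a b : Fin n}
    (ha : a = ⟨i, by omega⟩) (hb : b = ⟨i + 1, hi⟩) :
    (vBasis n).repr (sTilde i hi v) w =
      if w a = w b then substZ (simpleRefl i hi) ((vBasis n).repr v w) else
        dynR (lamF n - yF n * tailWt i w) (zF n a - zF n b) (yF n) (w a, w b) (w a, w b) *
            substZ (simpleRefl i hi) ((vBasis n).repr v (w ∘ simpleRefl i hi)) +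
          dynR (lamF n - yF n * tailWt i w) (zF n a - zF n b) (yF n) (w a, w b) (w b, w a) *
            substZ (simpleRefl i hi) ((vBasis n).repr v w) := by
  have hne : a ≠ b := by rw [ha, hb]; simp
  have hs : simpleRefl i hi = Equiv.swap a b := by rw [ha, hb, simpleRefl]
  induction v using V_induction with
  | h0 => simp
  | hadd u v hu hv =>
    simp only [map_add, Finsupp.add_apply, hu, hv]
    split_ifs <;> ring
  | hsmul f u =>
    rw [sTilde_smul_vBasis, ← ha, ← hb, RAt_vBasis hne]
    have hcast : ∀ m : Finset (Fin n), ∑ j ∈ m, (hwt ((u ∘ simpleRefl i hi) j) : F n) =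
        ((∑ j ∈ m, hwt ((u ∘ simpleRefl i hi) j) : ℤ) : F n) := fun m => by push_cast; rfl
    have htail : (∑ j ∈ Finset.univ.filter (fun m : Fin n => i + 2 ≤ (m : ℕ)),
        hwt ((u ∘ simpleRefl i hi) j)) = tailWt i u := tailWt_comp_simpleRefl hi u
    rw [hcast, htail]
    have hw := tailWt_comp_simpleRefl hi w
    rw [hs] at hw ⊢
    rw [comp_swap_comp_swap]
    simp only [Function.comp_apply, Equiv.swap_apply_left, Equiv.swap_apply_right,
      repr_smul_vBasis]
    by_cases h1 : u = w
    · subst h1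
      by_cases h : u a = u b
      · rw [if_pos h.symm, if_pos h, comp_swap_eq_self h, repr_smul_vBasis]
        simp
      · have hu : u ∘ Equiv.swap a b ≠ u := fun h' => h (by
          have := congrFun h' b
          simpa using this)
        rw [if_neg fun h' => h h'.symm, if_neg h, smul_add, smul_smul, smul_smul, map_add,
          Finsupp.add_apply, repr_smul_vBasis, repr_smul_vBasis, if_neg hu, if_neg hu.symm]
        simp [mul_comm]
    · by_cases h2 : u ∘ Equiv.swap a b = w
      · have h3 : u = w ∘ Equiv.swap a b := by rw [← h2, comp_swap_comp_swap]
        subst h3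
        have h : w a ≠ w b := fun h => h1 (comp_swap_eq_self h)
        simp only [Function.comp_apply, Equiv.swap_apply_left, Equiv.swap_apply_right, hw]
        rw [if_neg h, if_neg h, smul_add, smul_smul, smul_smul, map_add,
          Finsupp.add_apply, repr_smul_vBasis, repr_smul_vBasis, if_pos h2, if_neg h1]
        simp [mul_comm, h1]
      · have h3 : u ≠ w ∘ Equiv.swap a b := fun h => h2 (by rw [h, comp_swap_comp_swap])
        rw [if_neg h1, if_neg h3]
        split_ifs
        · rw [repr_smul_vBasis, if_neg h2, map_zero]
        · rw [repr_smul_vBasis, if_neg h2, map_zero, mul_zero, mul_zero, add_zero]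
        · rw [smul_add, smul_smul, smul_smul, map_add,
            Finsupp.add_apply, repr_smul_vBasis, repr_smul_vBasis, if_neg h1, if_neg h2]
          simp
        · rw [smul_add, smul_smul, smul_smul, map_add,
            Finsupp.add_apply, repr_smul_vBasis, repr_smul_vBasis, if_neg h1, if_neg h2]
          simp only [map_zero, mul_zero, add_zero]

lemma sTilde_smul {i : ℕ} (hi : i + 1 < n) (f : F n) (v : V n) :
    sTilde i hi (f • v) = substZ (simpleRefl i hi) f • sTilde i hi v := by
  refine (vBasis n).ext_elem fun w => ?_
  simp only [map_smul, Finsupp.smul_apply, smul_eq_mul, repr_sTilde hi _ w rfl rfl, map_mul]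
  split_ifs <;> ring

lemma sTilde_mem_lattice {i : ℕ} (hi : i + 1 < n) {v : V n} (hv : v ∈ lattice n) :
    sTilde i hi v ∈ lattice n := by
  rw [mem_lattice_iff] at hv ⊢
  intro w
  rw [repr_sTilde hi _ w rfl rfl]
  split_ifs
  · exact substZ_mem_L _ (hv _)
  · exact add_mem (mul_mem (dynR_mem_L _ _ _ _ _) (substZ_mem_L _ (hv _)))
      (mul_mem (dynR_mem_L _ _ _ _ _) (substZ_mem_L _ (hv _)))

end Operators

/-! ### The vectors `ξ_I` -/

section Xi

variable {n k : ℕ}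

lemma ind_injective : Function.Injective (ind (n := n)) := fun I J h => by
  ext j
  have := congrFun h j
  unfold ind at this
  split_ifs at this <;> simp_all

lemma ind_permSubset (σ : Equiv.Perm (Fin n)) (J : Subsets n k) :
    ind (permSubset σ J).1 = ind J.1 ∘ σ.symm := by
  ext j
  simp only [ind, mem_permSubset]
  rfl

lemma repr_xi (I : Subsets n k) (w : Fin n → Fin 2) :
    (vBasis n).repr (xi I) w = (Q I (zF n) (yF n))⁻¹ * ∑ J : Subsets n k,
      if ind J.1 = w then WMinus J (lamF n) (zF n ∘ elt I) (zF n) (yF n) else 0 := by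
  rw [xi, map_smul, map_sum, Finsupp.smul_apply, Finsupp.finsetSum_apply, smul_eq_mul]
  congr 1
  exact Finset.sum_congr rfl fun J _ => repr_smul_vBasis _ _ _

lemma repr_xi_ind (I J : Subsets n k) :
    (vBasis n).repr (xi I) (ind J.1) =
      (Q I (zF n) (yF n))⁻¹ * WMinus J (lamF n) (zF n ∘ elt I) (zF n) (yF n) := by
  rw [repr_xi, Finset.sum_eq_single J, if_pos rfl]
  · exact fun J' _ h => if_neg fun h' => h (Subtype.ext (ind_injective h'))
  · exact fun h => absurd (Finset.mem_univ _) h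

lemma repr_xi_eq_zero (I : Subsets n k) {w : Fin n → Fin 2}
    (hw : ¬∃ J : Subsets n k, ind J.1 = w) : (vBasis n).repr (xi I) w = 0 := by
  rw [repr_xi]
  exact mul_eq_zero_of_right _ (Finset.sum_eq_zero fun J _ => if_neg fun h => hw ⟨J, h⟩)

lemma xi_mem_lattice (I : Subsets n k) : xi I ∈ lattice n := by
  rw [mem_lattice_iff]
  intro w
  by_cases hw : ∃ J : Subsets n k, ind J.1 = w
  · obtain ⟨J, rfl⟩ := hw
    rw [repr_xi_ind]
    exact mul_mem (inv_Q_mem_L I) (WMinus_mem_L I J)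
  · rw [repr_xi_eq_zero I hw]
    exact zero_mem _

/-- The parameters in the slot `z` and the substituted values `z_I` are permuted together. The
reordering between `σ ∘ elt I` and `elt (permSubset σ I)` is harmless by symmetry in `t`. -/
lemma substZ_coeff (σ : Equiv.Perm (Fin n)) (I J : Subsets n k) :
    substZ σ ((Q I (zF n) (yF n))⁻¹ * WMinus J (lamF n) (zF n ∘ elt I) (zF n) (yF n)) =
      (Q (permSubset σ I) (zF n) (yF n))⁻¹ *
        WMinus J (lamF n) (zF n ∘ elt (permSubset σ I)) (zF n ∘ σ) (yF n) := by
  have hz : (substZ σ : F n → F n) ∘ zF n = zF n ∘ σ := funext fun i => substZ_zF σ i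
  have h1 := map_Q (substZ σ : F n ≃ₐ[ℂ] F n).toRingEquiv.toRingHom I (zF n) (yF n)
  have h2 := map_WMinus (substZ σ : F n ≃ₐ[ℂ] F n).toRingEquiv.toRingHom J (lamF n)
    (zF n ∘ elt I) (zF n) (yF n)
  change substZ σ _ = Q I (substZ σ ∘ zF n) (substZ σ (yF n)) at h1
  change substZ σ _ = WMinus J (substZ σ (lamF n)) ((substZ σ ∘ zF n) ∘ elt I)
    (substZ σ ∘ zF n) (substZ σ (yF n)) at h2
  rw [substZ_yF, hz] at h1
  rw [substZ_yF, substZ_lamF, hz] at h2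
  rw [map_mul, map_inv₀, h1, h2, Q_permSubset]
  obtain ⟨π, hπ⟩ := exists_perm_comp_elt σ I
  rw [Function.comp_assoc, hπ, ← Function.comp_assoc, WMinus_comp_perm]

lemma hwt_ind (J : Subsets n k) (j : Fin n) : hwt (ind J.1 j) = memSign J j := by
  unfold ind memSign hwt
  split_ifs <;> simp_all

lemma ind_eq_iff (J : Finset (Fin n)) (a b : Fin n) :
    ind J a = ind J b ↔ (a ∈ J ↔ b ∈ J) := by
  unfold ind
  split_ifs <;> simp_all

lemma xi_simpleRefl (I : Subsets n k) {i : ℕ} (hi : i + 1 < n) :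
    xi (permSubset (simpleRefl i hi) I) = sTilde i hi (xi I) := by
  refine (vBasis n).ext_elem fun w => ?_
  obtain ⟨a, ha⟩ : ∃ a : Fin n, a = ⟨i, by omega⟩ := ⟨_, rfl⟩
  obtain ⟨b, hb⟩ : ∃ b : Fin n, b = ⟨i + 1, hi⟩ := ⟨_, rfl⟩
  have hab : (a : ℕ) + 1 = b := by rw [ha, hb]
  have hs : simpleRefl i hi = Equiv.swap a b := by rw [ha, hb, simpleRefl]
  rw [repr_sTilde hi _ w ha hb]
  by_cases hw : ∃ J : Subsets n k, ind J.1 = w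
  · obtain ⟨J, rfl⟩ := hw
    have htail : tailWt i (ind J.1) = rightWt a J := by
      rw [rightWt, ha]
      exact Finset.sum_congr rfl fun m _ => hwt_ind J m
    have hcomp : ind J.1 ∘ simpleRefl i hi = ind (permSubset (simpleRefl i hi) J).1 := by
      rw [ind_permSubset, hs, Equiv.symm_swap]
    rw [hcomp, repr_xi_ind, repr_xi_ind, repr_xi_ind, substZ_coeff, substZ_coeff, htail, hs]
    split_ifs with h
    · rw [ind_eq_iff] at h
      rw [WMinus_swap_eq hab h _ (zF_injective.comp (elt_injective _))]
    · rw [ind_eq_iff] at h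
      have hm : lamF n - yF n * rightWt a J ≠ 0 := by
        have := lam_add_ne_zero (n := n) (-rightWt a J)
        push_cast at this
        intro h0
        apply this
        linear_combination h0
      rw [WMinus_eq_dynR hab h (lamF n) _ (zF n) (yF n) hm (z_sub_sub_ne_zero a b)]
      ring
  -- Index sequences that do not come from `k`-subsets are stable under the swap, so both sides
  -- vanish there.
  · have hw' : ¬∃ J : Subsets n k, ind J.1 = w ∘ simpleRefl i hi := by
      rintro ⟨J, hJ⟩
      refine hw ⟨permSubset (simpleRefl i hi) J, ?_⟩
      rw [ind_permSubset, hJ, hs, Equiv.symm_swap, comp_swap_comp_swap]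
    rw [repr_xi_eq_zero _ hw, repr_xi_eq_zero _ hw, repr_xi_eq_zero _ hw']
    simp

lemma xi_mk (I : Subsets n k) : xi (⟨I.1, rfl⟩ : Subsets n I.1.card) = xi I := by
  obtain ⟨I, rfl⟩ := I
  rfl

lemma sum_revSubset (I : Subsets n k) :
    ∑ j ∈ (revSubset I).1, (j : ℕ) = ∑ j ∈ I.1, (j.rev : ℕ) := by
  rw [revSubset, permSubset, Finset.sum_map]
  rfl

/-- The vectors `ξ_I`, for all `I`, are triangular with respect to the vectors `v_I`. -/
lemma linearIndependent_xi : LinearIndependent (F n)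
    fun I : Finset (Fin n) => xi (⟨I, rfl⟩ : Subsets n I.card) := by
  rw [Fintype.linearIndependent_iff]
  classical
  intro c hc
  by_contra! hne
  -- With `J` minimal for the reversed sum among the indices of nonzero coefficients, triangularity
  -- kills every other term in the coordinate at `ind J`.
  obtain ⟨J, hJ, hmin⟩ := Finset.exists_min_image (Finset.univ.filter fun I => c I ≠ 0)
    (fun I => ∑ j ∈ I, (j.rev : ℕ)) (by
      obtain ⟨I, hI⟩ := hne
      exact ⟨I, by simpa using hI⟩)
  have h := congrArg (fun v => (vBasis n).repr v (ind J)) hc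
  simp only [map_sum, map_smul, Finsupp.finsetSum_apply, Finsupp.smul_apply, smul_eq_mul,
    map_zero, Finsupp.zero_apply] at h
  rw [Finset.sum_eq_single J] at h
  · have h1 := repr_xi_ind (⟨J, rfl⟩ : Subsets n J.card) ⟨J, rfl⟩
    simp only at h1
    rw [h1] at h
    refine mul_ne_zero (by simpa using hJ) (mul_ne_zero (inv_ne_zero (Q_ne_zero _)) ?_) h
    exact WMinus_elt_self_ne_zero _ yF_ne_zero zF_injective z_sub_add_ne_zero lam_add_ne_zero
  · intro I _ hIJ
    by_cases hI : c I = 0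
    · rw [hI, zero_mul]
    refine mul_eq_zero_of_right _ ?_
    by_cases hcard : J.card = I.card
    · have h1 := repr_xi_ind (⟨I, rfl⟩ : Subsets n I.card) ⟨J, hcard⟩
      simp only at h1
      rw [h1, WMinus_elt_eq_zero (fun h => hIJ (congrArg Subtype.val h)), mul_zero]
      rw [sum_revSubset, sum_revSubset]
      exact hmin I (by simpa using hI)
    · exact repr_xi_eq_zero _ fun ⟨J', hJ'⟩ => hcard (by rw [← ind_injective hJ', J'.2])
  · exact fun h => absurd (Finset.mem_univ _) h

/-- The basis of the vectors `ξ_I`. -/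
def xiBasis (n : ℕ) : Module.Basis (Finset (Fin n)) (F n) (V n) :=
  basisOfLinearIndependentOfCardEqFinrank linearIndependent_xi (by
    rw [Module.finrank_eq_card_basis (vBasis n)]
    simp)

lemma xiBasis_apply (I : Finset (Fin n)) : xiBasis n I = xi (⟨I, rfl⟩ : Subsets n I.card) := by
  simp [xiBasis]

end Xi

/-! ### The action of the symmetric group -/

section Action

variable {n : ℕ}

/-- The operator which permutes the variables `z_a` and the vectors `ξ_I`. -/
def permOp (σ : Equiv.Perm (Fin n)) : Module.End ℂ (V n) where
  toFun v := ∑ I, substZ σ ((xiBasis n).repr v I) • xiBasis n (I.map σ.toEmbedding)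
  map_add' u v := by
    simp only [map_add, Finsupp.add_apply, add_smul, Finset.sum_add_distrib]
  map_smul' c v := by
    rw [RingHom.id_apply, Finset.smul_sum, ← algebraMap_smul (F n) c v]
    refine Finset.sum_congr rfl fun I _ => ?_
    rw [map_smul, Finsupp.smul_apply, smul_eq_mul, map_mul, AlgEquiv.commutes, mul_smul,
      algebraMap_smul]

lemma permOp_smul_xiBasis (σ : Equiv.Perm (Fin n)) (f : F n) (I : Finset (Fin n)) :
    permOp σ (f • xiBasis n I) = substZ σ f • xiBasis n (I.map σ.toEmbedding) := by
  change ∑ J : Finset (Fin n), substZ σ ((xiBasis n).repr (f • xiBasis n I) J) •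
    xiBasis n (J.map σ.toEmbedding) = _
  rw [Finset.sum_eq_single I]
  · simp
  · intro J _ h
    simp [h.symm]
  · exact fun h => absurd (Finset.mem_univ _) h

lemma End_ext_xiBasis {A B : Module.End ℂ (V n)}
    (h : ∀ (f : F n) I, A (f • xiBasis n I) = B (f • xiBasis n I)) : A = B := by
  refine LinearMap.ext fun v => ?_
  rw [← (xiBasis n).sum_repr v, map_sum, map_sum]
  exact Finset.sum_congr rfl fun I _ => h _ _

/-- The action of the symmetric group by the operators `permOp`. -/
def permAction (n : ℕ) : Equiv.Perm (Fin n) →* Module.End ℂ (V n) where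
  toFun := permOp
  map_one' := End_ext_xiBasis fun f I => by
    rw [permOp_smul_xiBasis, substZ_one, Module.End.one_apply]
    congr 2
    ext j
    rw [Finset.mem_map_equiv]
    rfl
  map_mul' σ τ := End_ext_xiBasis fun f I => by
    rw [Module.End.mul_apply, permOp_smul_xiBasis, permOp_smul_xiBasis, permOp_smul_xiBasis,
      substZ_mul, Finset.map_map]
    rfl

/-- Both sides are semilinear for the same substitution and agree on the basis `ξ_I` by
`xi_simpleRefl`. -/
lemma permAction_simpleRefl {i : ℕ} (hi : i + 1 < n) :
    permAction n (simpleRefl i hi) = sTilde i hi :=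
  End_ext_xiBasis fun f I => by
    rw [sTilde_smul, xiBasis_apply, ← xi_simpleRefl, ← xi_mk (permSubset _ _), ← xiBasis_apply,
      ← xiBasis_apply]
    exact permOp_smul_xiBasis _ _ _

/-- Generation as a monoid suits homomorphisms into `Module.End`, which is only a monoid under
composition. -/
lemma mclosure_simpleRefl (n : ℕ) :
    Submonoid.closure {σ | ∃ (i : ℕ) (hi : i + 1 < n), σ = simpleRefl i hi} = ⊤ := by
  cases n with
  | zero => exact top_unique fun σ _ => Subsingleton.elim 1 σ ▸ one_mem _
  | succ m =>
    refine top_unique ((Equiv.Perm.mclosure_swap_castSucc_succ m).ge.trans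
      (Submonoid.closure_mono ?_))
    rintro _ ⟨i, rfl⟩
    exact ⟨i, by omega, rfl⟩

lemma simpleRefl_mul_self {i : ℕ} (hi : i + 1 < n) : simpleRefl i hi * simpleRefl i hi = 1 :=
  Equiv.swap_mul_self _ _

/-- Both sides are the transposition of `x` and `z`. -/
lemma swap_braid {α : Type*} [DecidableEq α] {x y z : α} (hxy : x ≠ y) (hxz : x ≠ z)
    (hyz : y ≠ z) : Equiv.swap y z * (Equiv.swap x y * Equiv.swap y z) =
      Equiv.swap x y * (Equiv.swap y z * Equiv.swap x y) := by
  rw [← mul_assoc, ← mul_assoc, Equiv.swap_mul_swap_mul_swap hxy hxz, Equiv.swap_comm x y,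
    Equiv.swap_comm y z, Equiv.swap_mul_swap_mul_swap hyz.symm hxz.symm, Equiv.swap_comm]

lemma simpleRefl_braid {i : ℕ} (hi : i + 1 < n) (hi' : i + 1 + 1 < n) :
    simpleRefl (i + 1) hi' * (simpleRefl i hi * simpleRefl (i + 1) hi') =
      simpleRefl i hi * (simpleRefl (i + 1) hi' * simpleRefl i hi) :=
  swap_braid (by simp) (by simp [add_assoc]) (by simp)

lemma simpleRefl_comm {i j : ℕ} (hi : i + 1 < n) (hj : j + 1 < n) (h : i + 1 < j ∨ j + 1 < i) :
    simpleRefl i hi * simpleRefl j hj = simpleRefl j hj * simpleRefl i hi := by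
  rw [simpleRefl, simpleRefl, Equiv.mul_swap_eq_swap_mul, Equiv.swap_apply_of_ne_of_ne,
    Equiv.swap_apply_of_ne_of_ne] <;>
  · rw [ne_eq, Fin.mk.injEq]
    omega

lemma permAction_mem_lattice (σ : Equiv.Perm (Fin n)) :
    ∀ v ∈ lattice n, permAction n σ v ∈ lattice n := by
  have hσ : σ ∈ Submonoid.closure {σ | ∃ (i : ℕ) (hi : i + 1 < n), σ = simpleRefl i hi} := by
    rw [mclosure_simpleRefl]
    trivial
  induction hσ using Submonoid.closure_induction with
  | mem σ h =>
    obtain ⟨i, hi, rfl⟩ := h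
    rw [permAction_simpleRefl]
    exact fun v hv => sTilde_mem_lattice hi hv
  | one => simp
  | mul σ τ _ _ h1 h2 =>
    intro v hv
    rw [map_mul]
    exact h1 _ (h2 v hv)

end Action

end DynXi

end

theorem mainTheorem8 (n : ℕ) :
    -- the relations of the simple transpositions
    (∀ (i : ℕ) (hi : i + 1 < n), DynXi.sTilde i hi ∘ₗ DynXi.sTilde i hi = LinearMap.id) ∧
    (∀ (i : ℕ) (hi : i + 2 < n),
      DynXi.sTilde (i + 1) hi ∘ₗ DynXi.sTilde i (by omega) ∘ₗ DynXi.sTilde (i + 1) hi =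
        DynXi.sTilde i (by omega) ∘ₗ DynXi.sTilde (i + 1) hi ∘ₗ DynXi.sTilde i (by omega)) ∧
    (∀ (i j : ℕ) (hi : i + 1 < n) (hj : j + 1 < n), i + 1 < j ∨ j + 1 < i →
      DynXi.sTilde i hi ∘ₗ DynXi.sTilde j hj = DynXi.sTilde j hj ∘ₗ DynXi.sTilde i hi) ∧
    -- the commutation relations with multiplication by `z_a`
    (∀ (i : ℕ) (hi : i + 1 < n) (a : Fin n) (v : DynXi.V n),
      DynXi.sTilde i hi (DynXi.zF n a • v) =
        DynXi.zF n (DynXi.simpleRefl i hi a) • DynXi.sTilde i hi v) ∧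
    -- every `ξ_I` has its coefficients in `L_{λ,z,y}`
    (∀ (k : ℕ) (I : DynXi.Subsets n k), DynXi.xi I ∈ DynXi.lattice n) ∧
    -- there is a unique action of `S_n` in which `s_i` acts by `s̃_i`
    ∃ ρ : Equiv.Perm (Fin n) →* Module.End ℂ (DynXi.V n),
      (∀ (i : ℕ) (hi : i + 1 < n), ρ (DynXi.simpleRefl i hi) = DynXi.sTilde i hi) ∧
      (∀ ρ' : Equiv.Perm (Fin n) →* Module.End ℂ (DynXi.V n),
        (∀ (i : ℕ) (hi : i + 1 < n), ρ' (DynXi.simpleRefl i hi) = DynXi.sTilde i hi) → ρ' = ρ) ∧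
      -- it preserves the vectors with coefficients in `L_{λ,z,y}`
      (∀ (σ : Equiv.Perm (Fin n)), ∀ v ∈ DynXi.lattice n, ρ σ v ∈ DynXi.lattice n) ∧
      -- and it permutes the vectors `ξ_I`
      (∀ (k : ℕ) (I : DynXi.Subsets n k) (i : ℕ) (hi : i + 1 < n),
        DynXi.xi (DynXi.permSubset (DynXi.simpleRefl i hi) I) =
          DynXi.sTilde i hi (DynXi.xi I)) := by
  refine ⟨fun i hi => ?_, fun i hi => ?_, fun i j hi hj h => ?_, fun i hi a v => ?_,
    fun k I => DynXi.xi_mem_lattice I, DynXi.permAction n,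
    fun i hi => DynXi.permAction_simpleRefl hi, fun ρ' hρ' => ?_,
    DynXi.permAction_mem_lattice, fun k I i hi => DynXi.xi_simpleRefl I hi⟩
  -- Each relation is the image under `permAction` of the corresponding relation in `S_n`.
  · rw [← DynXi.permAction_simpleRefl, ← Module.End.mul_eq_comp, ← map_mul,
      DynXi.simpleRefl_mul_self, map_one]
    rfl
  · simp only [← DynXi.permAction_simpleRefl, ← Module.End.mul_eq_comp, ← map_mul]
    rw [DynXi.simpleRefl_braid _ hi]
  · simp only [← DynXi.permAction_simpleRefl, ← Module.End.mul_eq_comp, ← map_mul]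
    rw [DynXi.simpleRefl_comm hi hj h]
  · rw [DynXi.sTilde_smul, DynXi.substZ_zF]
  · refine MonoidHom.eq_of_eqOn_denseM (DynXi.mclosure_simpleRefl n) ?_
    rintro _ ⟨i, hi, rfl⟩
    rw [hρ' i hi, DynXi.permAction_simpleRefl hi]
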